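/- Let $\mathbb{T}^2=\mathbb{R}^2/2\pi\mathbb{Z}^2$ with Lebesgue measure, and let $x_1,x_2\in\mathbb{T}^2$ be such that $x_0/\pi$ is Diophantine, where $x_0\in\mathbb{R}^2$ represents $x_2-x_1$. Here $(\alpha_1,\alpha_2)\in\mathbb{R}^2$ is called Diophantine if there are $\kappa\in\mathbb{R}$ and $C>0$ with $\max_{j=1,2}|\alpha_j-p_j/q|>C/q^{\kappa}$ for all $p_1,p_2,q\in\mathbb{Z}$, $q>0$. Two sets $A,B\subseteq\mathbb{R}$ weakly interlace if $A\cap B=\emptyset$ and there is a constant $C$ such that between any two consecutive elements of $A$ there are at most $C$ elements of $B$, and vice versa. For $\lambda\in\mathbb{R}$ that is not an eigenvalue of $-\Delta$ on $\mathbb{T}^2$ and $y\in\mathbb{T}^2$, let $G_\lambda(\cdot,y)=(\Delta+\lambda)^{-1}\delta_y$ be the Green's function, i.e. the unique element of $L^2(\mathbb{T}^2)$ with $\int_{\mathbb{T}^2} G_\lambda(x,y)\,(\Delta\varphi+\lambda\varphi)(x)\,dx=\varphi(y)$ for all $\varphi\in C^\infty(\mathbb{T}^2)$. For $(d_1,d_2)\in\mathbb{C}^2\setminus\{(0,0)\}$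 put $G_\lambda(x;d_1,d_2)=d_1G_\lambda(x,x_1)+d_2G_\lambda(x,x_2)$ and $g_\lambda(x;d_1,d_2)=G_\lambda(x;d_1,d_2)/\|G_\lambda(\cdot\,;d_1,d_2)\|_2$. Theorem 1.1. For every $\epsilon>0$ and every set $\Lambda_0\subseteq\mathbb{R}$ that weakly interlaces with the set of eigenvalues of $-\Delta$ on $\mathbb{T}^2$, there is a subset $\Lambda_\infty\subseteq\Lambda_0$ of density one, in the sense that $$\frac{\#\big((\Lambda_0\setminus\Lambda_\infty)\cap[0,X]\big)}{\#\big(\Lambda_0\cap[0,X]\big)}\to 0\qquad(X\to\infty)$$ (the quotient being read as $0$ where the denominator vanishes), such that for every $a\in C^\infty(\mathbb{T}^2)$, $$\int_{\mathbb{T}^2}a(x)\,|g_\lambda(x;d_1,d_2)|^2\,dx=\frac{1}{4\pi^2}\int_{\mathbb{T}^2}a(x)\,dx+O\big(\lambda^{-1/8+\epsilon}\big)$$ as $\lambda\to\infty$ along $\Lambda_\infty$, uniformly in $(d_1,d_2)\neq(0,0)$: there are constants $K$ and $\lambda_1$, independent of $\lambda$ and of $(d_1,d_2)$, such that the difference of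 the two integrals is at most $K\lambda^{-1/8+\epsilon}$ in absolute value for all $\lambda\in\Lambda_\infty$ with $\lambda\ge\lambda_1$ and all $(d_1,d_2)\ne(0,0)$. -/

import Mathlib

open Real Set Filter Topology MeasureTheory
open scoped ContDiff

noncomputable section

instance factTwoPiPos : Fact ((0 : ℝ) < 2 * π) := ⟨Real.two_pi_pos⟩

/-- The square torus `ℝ² / 2πℤ²`.  Its `volume` is Lebesgue measure, of total mass `4π²`. -/
abbrev Torus : Type := Fin 2 → AddCircle (2 * π)

/-- The quotient map `ℝ² → ℝ² / 2πℤ²`. -/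
def toTorus (x : Fin 2 → ℝ) : Torus := fun i => (x i : AddCircle (2 * π))

/-- `a ∈ C^∞(𝕋²)`: the `2πℤ²`-periodic function on `ℝ²` given by `a` is smooth. -/
def SmoothOnTorus (a : Torus → ℂ) : Prop :=
  ContDiff ℝ ∞ (fun x : Fin 2 → ℝ => a (toTorus x))

/-- The Laplacian `Δ = ∂₀² + ∂₁²` on functions on the torus: `∂ᵢ² φ (p)` is the second derivative
at `t = 0` of `t ↦ φ (p + t eᵢ)`. -/
def torusLaplacian (φ : Torus → ℂ) (p : Torus) : ℂ :=
  ∑ i : Fin 2, iteratedDeriv 2 (fun t : ℝ => φ (p + toTorus (Pi.single i t))) 0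

/-- The eigenvalues of `-Δ` on the torus. -/
def laplaceEigenvalues : Set ℝ :=
  {lam | ∃ f : Torus → ℂ, SmoothOnTorus f ∧ f ≠ 0 ∧
    ∀ p, -torusLaplacian f p = (lam : ℂ) * f p}

/-- `G = G_λ(·, y) = (Δ + λ)⁻¹ δ_y`: the function `G` lies in `L²(𝕋²)` and solves
`(Δ + λ) G = δ_y` in the sense of distributions.  For `λ` outside the spectrum of `-Δ` there is
exactly one such `G` up to null sets. -/
def IsGreenFunction (lam : ℝ) (y : Torus) (G : Torus → ℂ) : Prop :=
  MemLp G 2 volume ∧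
    ∀ φ : Torus → ℂ, SmoothOnTorus φ →
      ∫ x, G x * (torusLaplacian φ x + (lam : ℂ) * φ x) = φ y

/-- `G / ‖G‖₂`. -/
def l2Normalize (G : Torus → ℂ) (x : Torus) : ℂ :=
  G x / (((eLpNorm G 2 volume).toReal : ℝ) : ℂ)

/-- `v` is Diophantine of type `κ`. -/
def IsDiophantineOfType (v : Fin 2 → ℝ) (κ : ℝ) : Prop :=
  ∃ C : ℝ, 0 < C ∧ ∀ p₁ p₂ q : ℤ, 0 < q →
    C / (q : ℝ) ^ κ < max |v 0 - (p₁ : ℝ) / (q : ℝ)| |v 1 - (p₂ : ℝ) / (q : ℝ)|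

/-- `v` is Diophantine (of some type).  The property does not change when an integer vector is
added to `v`. -/
def IsDiophantine (v : Fin 2 → ℝ) : Prop :=
  ∃ κ : ℝ, IsDiophantineOfType v κ

/-- Between any two consecutive elements of `A` there are at most `C` elements of `B`. -/
def AtMostBetweenConsecutive (C : ℕ) (A B : Set ℝ) : Prop :=
  ∀ s ∈ A, ∀ t ∈ A, s < t → Ioo s t ∩ A = ∅ → (Ioo s t ∩ B).encard ≤ C

/-- `A` and `B` weakly interlace: they are disjoint, and for some `C` there are at most `C` elements
of either set between any two consecutive elements of the other. -/
def WeaklyInterlaces (A B : Set ℝ) : Prop :=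
  A ∩ B = ∅ ∧ ∃ C : ℕ, AtMostBetweenConsecutive C A B ∧ AtMostBetweenConsecutive C B A

/-- `S` has density one in `A`: it is a subset of `A`, and the proportion of those elements of
`A ∩ [0, X]` that are not in `S` tends to `0` as `X → ∞`.  It is meant for sets `A` that have
finitely many elements in each `[0, X]`; stated through the complement, it is also right if some
(or all) of these `A ∩ [0, X]` are empty. -/
def HasDensityOne (S A : Set ℝ) : Prop :=
  S ⊆ A ∧
    Tendsto (fun X : ℝ => (((A \ S) ∩ Icc 0 X).ncard : ℝ) / ((A ∩ Icc 0 X).ncard : ℝ))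
      atTop (𝓝 0)

end

/-! Let `F = d₁ G₁ + d₂ G₂` and `D = |d₁|² + |d₂|²`. Testing `(Δ + λ) G = δ_y` on characters gives
`|F̂(k)|² = |d₁ + d₂ exp(-i k·x₀)|² / (|k|² - λ)²`. The `l`-th Fourier coefficient of `|F|²` is the
correlation `∑ conj F̂(k) F̂(k - l)`, so the task is to bound these correlations for `0 < |l| ≤
λ^δ`; larger `l` are absorbed by the rapid decay of the coefficients of `a`
(`norm_integral_mul_norm_sq_sub_le`).

Call `||k|² - λ| < L = λ^(1/4 - 3δ)` the window. If no two points of the window differ by such an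
`l`, every product in the correlation has a factor outside the window, and the correlation is at
most `2ρ‖F‖²`, where `ρ²` bounds the share of the mass outside (`norm_integral_chr_mul_norm_sq_le`).
As `n` has `O(n^δ)` representations as a sum of two squares, the outside mass is `O(D λ^δ
L^(-1+2δ))` (`exists_sum_inv_sq_le`). The total mass is at least `D λ^(-4δ)` as soon as some `k`
with `||k|² - λ| ≤ λ^δ` has `|sin (k·x₀)| ≥ λ^(-δ)`, which rules out cancellation between the two
point sources (`le_integral_green_comb`). The quotient permits `ρ ≍ λ^(-1/8 + 5δ)`, uniformly in
`(d₁, d₂)`.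

Both conditions rarely fail. A near pair with difference `l` puts `k` in a strip orthogonal to `l`;
counting strips gives `O(X^(1-4δ))` bad elements up to `X` (`exists_card_hasNearPair_le`). If all
`k` on a circle `|k|² = a² + b²` have small `sin (k·x₀)`, then `2a x₀` is close to `πℤ²`, and the
Diophantine condition spaces such `a` apart (`exists_card_isResonant_le`); since long gaps between
eigenvalues are rare too, this costs `O(X^(1-σ))` elements (`exists_card_not_hasNonresonant_le`). An
unbounded `Λ₀` has `≫ X^(1-σ/2)` elements up to `X`, by interlacing and the bound on
representations, so the bad ones have density zero (`hasDensityOne_goodSet`). -/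

noncomputable section

open scoped ComplexConjugate

/-! ### Characters of the torus, Parseval's identity and Fourier inversion -/

/-- The character `p ↦ exp (i k · p)` of the torus. -/
def chr (k : ℤ × ℤ) : C(Torus, ℂ) where
  toFun p := fourier k.1 (p 0) * fourier k.2 (p 1)
  continuous_toFun := by fun_prop

lemma chr_apply (k : ℤ × ℤ) (p : Torus) : chr k p = fourier k.1 (p 0) * fourier k.2 (p 1) := rfl

lemma chr_zero : chr 0 = 1 := by
  ext p
  simp [chr_apply]

lemma chr_add (k l : ℤ × ℤ) (p : Torus) : chr (k + l) p = chr k p * chr l p := by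
  simp only [chr_apply, Prod.fst_add, Prod.snd_add, fourier_add]
  ring

lemma chr_neg (k : ℤ × ℤ) (p : Torus) : chr (-k) p = conj (chr k p) := by
  simp [chr_apply]

lemma norm_chr (k : ℤ × ℤ) (p : Torus) : ‖chr k p‖ = 1 := by
  simp only [chr_apply, fourier_apply, norm_mul, Circle.norm_coe, mul_one]

lemma chr_apply_add (k : ℤ × ℤ) (p q : Torus) : chr k (p + q) = chr k p * chr k q := by
  simp only [chr_apply, Pi.add_apply, fourier_apply, smul_add, AddCircle.toCircle_add,
    Circle.coe_mul]
  ring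

lemma chr_toTorus (k : ℤ × ℤ) (x : Fin 2 → ℝ) :
    chr k (toTorus x) = Complex.exp (Complex.I * ((k.1 * x 0 + k.2 * x 1 : ℝ) : ℂ)) := by
  have h : ∀ (n : ℤ) (t : ℝ), fourier n ((t : ℝ) : AddCircle (2 * π)) =
      Complex.exp (Complex.I * ((n * t : ℝ) : ℂ)) := by
    intro n t
    rw [fourier_coe_apply]
    congr 1
    push_cast
    have : (π : ℂ) ≠ 0 := by exact_mod_cast Real.pi_ne_zero
    field_simp
  simp only [chr_apply, toTorus, h, ← Complex.exp_add]
  congr 1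
  push_cast
  ring

lemma toTorus_add (x y : Fin 2 → ℝ) : toTorus (x + y) = toTorus x + toTorus y := by
  ext i; simp [toTorus]

lemma isOpenQuotientMap_toTorus : IsOpenQuotientMap toTorus :=
  IsOpenQuotientMap.piMap fun _ => QuotientAddGroup.isOpenQuotientMap_mk

lemma SmoothOnTorus.continuous {a : Torus → ℂ} (ha : SmoothOnTorus a) : Continuous a :=
  isOpenQuotientMap_toTorus.isQuotientMap.continuous_iff.2 (ContDiff.continuous ha)

lemma smoothOnTorus_chr (k : ℤ × ℤ) : SmoothOnTorus (chr k) := by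
  unfold SmoothOnTorus
  simp only [chr_toTorus]
  have h1 : ContDiff ℝ ∞ fun x : Fin 2 → ℝ => (k.1 * x 0 + k.2 * x 1 : ℝ) := by fun_prop
  have := Complex.ofRealCLM.contDiff.comp h1
  exact Complex.contDiff_exp.comp (contDiff_const.mul this)

lemma volume_torus : (volume : Measure Torus).real univ = 4 * π ^ 2 := by
  rw [measureReal_def, volume_pi, Measure.pi_univ]
  simp [AddCircle.measure_univ, ENNReal.toReal_ofReal pi_pos.le]
  ring

/-- At the point whose only nonzero coordinate is the `i`-th, equal to `π / kᵢ`, the character takes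
the value `-1` unless `kᵢ = 0`. -/
lemma exists_chr_ne_one {k : ℤ × ℤ} (hk : k ≠ 0) : ∃ q : Torus, chr k q ≠ 1 := by
  by_contra! h
  apply hk
  have key : ∀ n : ℤ, Complex.exp (Complex.I * ((n * (π / n) : ℝ) : ℂ)) = 1 → n = 0 := by
    intro n hn
    by_contra hne
    have : (n : ℝ) ≠ 0 := by exact_mod_cast hne
    rw [mul_div_cancel₀ _ this, mul_comm, Complex.exp_pi_mul_I] at hn
    norm_num at hn
  ext
  · apply key
    have := h (toTorus (fun i => if i = 0 then π / k.1 else 0))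
    simpa [chr_toTorus] using this
  · apply key
    have := h (toTorus (fun i => if i = 1 then π / k.2 else 0))
    simpa [chr_toTorus] using this

/-- Translation by `q` preserves the integral and also multiplies it by `chr k q ≠ 1`. -/
lemma integral_chr {k : ℤ × ℤ} (hk : k ≠ 0) : ∫ p, chr k p = 0 := by
  obtain ⟨q, hq⟩ := exists_chr_ne_one hk
  have h := integral_add_right_eq_self (μ := (volume : Measure Torus)) (fun p => chr k p) q
  simp only [chr_apply_add] at h
  rw [integral_mul_const] at h
  have : (∫ p, chr k p) * (chr k q - 1) = 0 := by linear_combination h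
  exact (mul_eq_zero.1 this).resolve_right (sub_ne_zero.2 hq)

/-- The star subalgebra of trigonometric polynomials. -/
def trigPoly : StarSubalgebra ℂ C(Torus, ℂ) where
  toSubalgebra := Algebra.adjoin ℂ (range chr)
  star_mem' := by
    change Algebra.adjoin ℂ (range chr) ≤ star (Algebra.adjoin ℂ (range chr))
    refine Algebra.adjoin_le ?_
    rintro _ ⟨n, rfl⟩
    refine Algebra.subset_adjoin ⟨-n, ?_⟩
    ext1 x
    simp only [chr_neg, starRingEnd_apply, ContinuousMap.star_apply]

lemma trigPoly_coe :
    Subalgebra.toSubmodule trigPoly.toSubalgebra = Submodule.span ℂ (range chr) := by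
  apply Algebra.adjoin_eq_span_of_subset
  refine .trans (fun x ↦ Submonoid.closure_induction (fun _ ↦ id) ⟨0, chr_zero⟩ ?_)
    Submodule.subset_span
  rintro _ _ _ _ ⟨m, rfl⟩ ⟨n, rfl⟩
  refine ⟨m + n, ?_⟩
  ext z
  simp [chr_add]

lemma trigPoly_separatesPoints : trigPoly.SeparatesPoints := by
  intro x y hxy
  have key : ∀ i : Fin 2, ∃ k, ∀ z : Torus, chr k z = fourier 1 (z i) := by
    intro i
    fin_cases i
    · exact ⟨(1, 0), fun z => by simp [chr_apply]⟩
    · exact ⟨(0, 1), fun z => by simp [chr_apply]⟩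
  rw [Ne, funext_iff, not_forall] at hxy
  obtain ⟨i, hi⟩ := hxy
  obtain ⟨k, hk⟩ := key i
  refine ⟨_, ⟨chr k, Algebra.subset_adjoin ⟨k, rfl⟩, rfl⟩, ?_⟩
  dsimp only
  rw [hk, hk, fourier_one, fourier_one]
  contrapose hi
  replace hi := Circle.coe_injective hi
  exact AddCircle.injective_toCircle two_pi_pos.ne' hi

lemma span_chr_closure_eq_top : (Submodule.span ℂ (range chr)).topologicalClosure = ⊤ := by
  rw [← trigPoly_coe]
  exact congr_arg (Subalgebra.toSubmodule <| StarSubalgebra.toSubalgebra ·)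
    (ContinuousMap.starSubalgebra_topologicalClosure_eq_top_of_separatesPoints _
      trigPoly_separatesPoints)

/-- The `L²`-normalized character. -/
abbrev chrLp (k : ℤ × ℤ) : Lp ℂ 2 (volume : Measure Torus) :=
  ContinuousMap.toLp (E := ℂ) 2 volume ℂ (((2 * π : ℝ)⁻¹ : ℂ) • chr k)

lemma orthonormal_chrLp : Orthonormal ℂ chrLp := by
  rw [orthonormal_iff_ite]
  intro m n
  rw [ContinuousMap.inner_toLp]
  have : ∀ x, ((((2 * π : ℝ)⁻¹ : ℂ) • chr n) x) * conj ((((2 * π : ℝ)⁻¹ : ℂ) • chr m) x) =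
      ((4 * π ^ 2 : ℝ)⁻¹ : ℂ) * chr (n + -m) x := by
    intro x
    rw [chr_add, chr_neg]
    simp [map_ofNat]
    ring
  simp_rw [this]
  rw [integral_const_mul]
  split_ifs with h
  · subst h
    have h2 := volume_torus
    simp only [add_neg_cancel, chr_zero, ContinuousMap.one_apply, integral_const, h2]
    rw [Complex.real_smul, mul_one]
    exact inv_mul_cancel₀ (by exact_mod_cast (by positivity : (4 * π ^ 2 : ℝ) ≠ 0))
  · rw [integral_chr, mul_zero]
    rwa [← sub_eq_add_neg, sub_ne_zero, ne_comm]

lemma span_chrLp_closure_eq_top :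
    (Submodule.span ℂ (range chrLp)).topologicalClosure = ⊤ := by
  have h1 : Submodule.span ℂ (range fun k => (((2 * π : ℝ)⁻¹ : ℂ) • chr k)) =
      Submodule.span ℂ (range chr) := by
    have hc : ((2 * π : ℝ)⁻¹ : ℂ) ≠ 0 := by
      exact_mod_cast inv_ne_zero two_pi_pos.ne'
    apply le_antisymm
    · rw [Submodule.span_le]
      rintro _ ⟨k, rfl⟩
      exact Submodule.smul_mem _ _ (Submodule.subset_span ⟨k, rfl⟩)
    · rw [Submodule.span_le]
      rintro _ ⟨k, rfl⟩
      have := Submodule.smul_mem _ ((2 * π : ℝ)⁻¹ : ℂ)⁻¹ (Submodule.subset_span (R := ℂ)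
        (mem_range_self (f := fun k => (((2 * π : ℝ)⁻¹ : ℂ) • chr k)) k))
      rwa [inv_smul_smul₀ hc] at this
  have h2 := span_chr_closure_eq_top
  rw [← h1] at h2
  simpa only [Submodule.map_span, ContinuousLinearMap.coe_coe, ← range_comp, Function.comp_def] using
    (ContinuousMap.toLp_denseRange ℂ (volume : Measure Torus) ℂ
      (by norm_num : (2 : ENNReal) ≠ ⊤)).topologicalClosure_map_submodule h2

/-- The Hilbert basis of normalized characters. -/
def chrBasis : HilbertBasis (ℤ × ℤ) ℂ (Lp ℂ 2 (volume : Measure Torus)) :=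
  HilbertBasis.mk orthonormal_chrLp span_chrLp_closure_eq_top.ge

/-- The Fourier coefficient `∫ exp (-i k · p) F(p) dp`. -/
def coeff (F : Torus → ℂ) (k : ℤ × ℤ) : ℂ := ∫ p, chr (-k) p * F p

lemma coeff_congr_ae {F G : Torus → ℂ} (h : F =ᵐ[volume] G) (k : ℤ × ℤ) :
    coeff F k = coeff G k := by
  apply integral_congr_ae
  filter_upwards [h] with p hp
  rw [hp]

lemma chrBasis_repr (F : Lp ℂ 2 (volume : Measure Torus)) (k : ℤ × ℤ) :
    chrBasis.repr F k = ((2 * π : ℝ)⁻¹ : ℂ) * coeff F k := by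
  rw [chrBasis.repr_apply_apply, chrBasis, HilbertBasis.coe_mk, L2.inner_def, coeff,
    ← integral_const_mul]
  apply integral_congr_ae
  filter_upwards [ContinuousMap.coeFn_toLp (E := ℂ) (p := 2) (𝕜 := ℂ) (volume : Measure Torus)
    (((2 * π : ℝ)⁻¹ : ℂ) • chr k)] with p hp
  rw [hp, chr_neg]
  simp [map_ofNat]
  ring

/-- Parseval's identity. -/
lemma hasSum_coeff_mul {F G : Torus → ℂ} (hF : MemLp F 2 volume) (hG : MemLp G 2 volume) :
    HasSum (fun k => conj (coeff F k) * coeff G k)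
      ((4 * π ^ 2 : ℝ) * ∫ p, conj (F p) * G p) := by
  have h := chrBasis.hasSum_inner_mul_inner (hF.toLp F) (hG.toLp G)
  have h1 : ∀ k, inner ℂ (hF.toLp F) (chrBasis k) * inner ℂ (chrBasis k) (hG.toLp G) =
      ((4 * π ^ 2 : ℝ)⁻¹ : ℂ) * (conj (coeff F k) * coeff G k) := by
    intro k
    rw [← inner_conj_symm, ← chrBasis.repr_apply_apply, ← chrBasis.repr_apply_apply,
      chrBasis_repr, chrBasis_repr, coeff_congr_ae hF.coeFn_toLp, coeff_congr_ae hG.coeFn_toLp]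
    simp [map_ofNat]
    ring
  have h2 : inner ℂ (hF.toLp F) (hG.toLp G) = ∫ p, conj (F p) * G p := by
    rw [L2.inner_def]
    apply integral_congr_ae
    filter_upwards [hF.coeFn_toLp, hG.coeFn_toLp] with p h1 h2
    rw [h1, h2]
    simp [mul_comm]
  simp only [h1] at h
  rw [h2] at h
  have hc : ((4 * π ^ 2 : ℝ) : ℂ) ≠ 0 := by
    exact_mod_cast (by positivity : (4 * π ^ 2 : ℝ) ≠ 0)
  have h3 := h.mul_left ((4 * π ^ 2 : ℝ) : ℂ)
  simpa only [mul_inv_cancel_left₀ hc] using h3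

lemma hasSum_norm_coeff_sq {F : Torus → ℂ} (hF : MemLp F 2 volume) :
    HasSum (fun k => ‖coeff F k‖ ^ 2) (4 * π ^ 2 * ∫ p, ‖F p‖ ^ 2) := by
  have h := hasSum_coeff_mul hF hF
  simp only [Complex.conj_mul'] at h
  rw [← Complex.hasSum_ofReal]
  convert! h using 1
  · ext k; push_cast; rfl
  · push_cast
    rw [← integral_complex_ofReal]
    push_cast
    rfl

lemma integrable_chr_mul {F : Torus → ℂ} (hF : Integrable F) (k : ℤ × ℤ) :
    Integrable (fun p => chr k p * F p) := by
  refine hF.bdd_mul (c := 1) (chr k).continuous.aestronglyMeasurable ?_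
  filter_upwards with p
  rw [norm_chr]

lemma norm_coeff_le {F : Torus → ℂ} (k : ℤ × ℤ) : ‖coeff F k‖ ≤ ∫ p, ‖F p‖ := by
  refine (norm_integral_le_integral_norm _).trans_eq ?_
  simp only [norm_mul, norm_chr, one_mul]

lemma coeff_chr_mul (F : Torus → ℂ) (k l : ℤ × ℤ) :
    coeff (fun p => chr l p * F p) k = coeff F (k - l) := by
  unfold coeff
  congr 1
  ext p
  rw [← mul_assoc, ← chr_add]
  congr 3
  abel

/-- Correlations of the Fourier coefficients of `F` are the Fourier coefficients of `|F|²`. -/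
lemma hasSum_coeff_shift {F : Torus → ℂ} (hF : MemLp F 2 volume) (l : ℤ × ℤ) :
    HasSum (fun k => conj (coeff F k) * coeff F (k - l))
      ((4 * π ^ 2 : ℝ) * ∫ p, chr l p * (‖F p‖ ^ 2 : ℝ)) := by
  have hG : MemLp (fun p => chr l p * F p) 2 volume := by
    refine hF.of_le ((chr l).continuous.aestronglyMeasurable.mul hF.aestronglyMeasurable) ?_
    filter_upwards with p
    rw [norm_mul, norm_chr, one_mul]
  have h := hasSum_coeff_mul hF hG
  simp only [coeff_chr_mul] at h
  convert! h using 4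
  rename_i p
  rw [mul_left_comm, Complex.conj_mul']
  push_cast
  rfl

/-- A continuous function on the torus vanishes if its Fourier coefficients do. -/
lemma eq_zero_of_coeff_eq_zero {f : Torus → ℂ} (hf : Continuous f) (h : ∀ k, coeff f k = 0) :
    f = 0 := by
  have hL : MemLp f 2 volume := hf.memLp_of_hasCompactSupport (HasCompactSupport.of_compactSpace f)
  have h1 := hasSum_norm_coeff_sq hL
  simp only [h, norm_zero, ne_eq, OfNat.ofNat_ne_zero, not_false_eq_true, zero_pow] at h1
  have h2 : ∫ p, ‖f p‖ ^ 2 = 0 := by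
    have := h1.unique hasSum_zero
    have hp : (4 * π ^ 2 : ℝ) ≠ 0 := by positivity
    exact (mul_eq_zero.1 this).resolve_left hp
  have hc : Continuous fun p => ‖f p‖ ^ 2 := by fun_prop
  rw [integral_eq_zero_iff_of_nonneg (fun p => by positivity)
    (hc.integrable_of_hasCompactSupport (HasCompactSupport.of_compactSpace _))] at h2
  have h3 := (hc.ae_eq_iff_eq volume continuous_zero).1 h2
  ext p
  have := congr_fun h3 p
  simpa using this

/-- Fourier inversion for a continuous function with summable Fourier coefficients. -/
lemma hasSum_coeff_mul_chr {f : Torus → ℂ} (hf : Continuous f)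
    (hs : Summable fun k => ‖coeff f k‖) (p : Torus) :
    HasSum (fun k => ((4 * π ^ 2 : ℝ) : ℂ)⁻¹ * coeff f k * chr k p) (f p) := by
  set c : ℂ := ((4 * π ^ 2 : ℝ) : ℂ)⁻¹ with hc
  have hsum : Summable fun k => ‖c * coeff f k‖ := by
    simpa only [norm_mul] using hs.mul_left ‖c‖
  have hbd : ∀ k q, ‖c * coeff f k * chr k q‖ ≤ ‖c * coeff f k‖ := by
    intro k q
    rw [norm_mul, norm_chr, mul_one]
  -- The sum of the series is continuous with the same coefficients as `f`, so uniqueness for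
  -- continuous functions makes them equal everywhere, not just almost everywhere.
  set g : Torus → ℂ := fun q => ∑' k, c * coeff f k * chr k q with hg
  have hgc : Continuous g :=
    continuous_tsum (fun k => by fun_prop) hsum hbd
  have hgk : ∀ l, coeff g l = coeff f l := by
    intro l
    have h1 : coeff g l = ∫ q, ∑' k, (c * coeff f k) * chr (k - l) q := by
      refine integral_congr_ae (Eventually.of_forall fun q => ?_)
      dsimp only [hg]
      rw [← tsum_mul_left]
      congr 1
      ext k
      rw [sub_eq_add_neg, chr_add]
      ring
    have hint : ∀ k, Integrable (fun q => (c * coeff f k) * chr (k - l) q) volume := fun k =>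
      Continuous.integrable_of_hasCompactSupport (by fun_prop) (HasCompactSupport.of_compactSpace _)
    rw [h1, ← integral_tsum_of_summable_integral_norm hint]
    · rw [tsum_eq_single l]
      · rw [integral_const_mul, sub_self, chr_zero]
        have h2 := volume_torus
        simp only [ContinuousMap.one_apply, integral_const, h2]
        rw [Complex.real_smul, mul_one, hc]
        have : ((4 * π ^ 2 : ℝ) : ℂ) ≠ 0 := by
          exact_mod_cast (by positivity : (4 * π ^ 2 : ℝ) ≠ 0)
        field_simp
      · intro k hk
        rw [integral_const_mul, integral_chr (sub_ne_zero.2 hk), mul_zero]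
    · simp only [norm_mul, norm_chr, mul_one, integral_const, smul_eq_mul]
      simpa only [norm_mul] using hsum.mul_left _
  have hfg : g - f = 0 := by
    refine eq_zero_of_coeff_eq_zero (hgc.sub hf) fun k => ?_
    have hi : ∀ {F : Torus → ℂ}, Continuous F → Integrable F volume := fun hF =>
      hF.integrable_of_hasCompactSupport (HasCompactSupport.of_compactSpace _)
    have : coeff (g - f) k = coeff g k - coeff f k := by
      unfold coeff
      rw [← integral_sub (integrable_chr_mul (hi hgc) _) (integrable_chr_mul (hi hf) _)]
      simp only [Pi.sub_apply, mul_sub]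
    rw [this, hgk, sub_self]
  rw [← congr_fun (sub_eq_zero.1 hfg) p]
  exact (Summable.of_norm_bounded hsum (fun k => hbd k p)).hasSum

/-! ### Derivatives, the spectrum and the coefficients of the Green function -/

/-- The `i`-th partial derivative of a function on the torus. -/
def partialDeriv (i : Fin 2) (φ : Torus → ℂ) (p : Torus) : ℂ :=
  deriv (fun t : ℝ => φ (p + toTorus (Pi.single i t))) 0

/-- The `i`-th component of a frequency. -/
def freq (k : ℤ × ℤ) (i : Fin 2) : ℤ := ![k.1, k.2] i

/-- `|k|²` as a natural number. -/
def nsq (k : ℤ × ℤ) : ℕ := k.1.natAbs ^ 2 + k.2.natAbs ^ 2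

lemma nsq_cast (k : ℤ × ℤ) : (nsq k : ℝ) = (k.1 : ℝ) ^ 2 + (k.2 : ℝ) ^ 2 := by
  have : ((nsq k : ℤ)) = k.1 ^ 2 + k.2 ^ 2 := by simp [nsq]
  exact_mod_cast this

lemma chr_toTorus_single (k : ℤ × ℤ) (i : Fin 2) (t : ℝ) :
    chr k (toTorus (Pi.single i t)) = Complex.exp (Complex.I * freq k i * t) := by
  rw [chr_toTorus, freq]
  fin_cases i <;> simp [mul_assoc]

section Derivatives

variable {φ : Torus → ℂ}

lemma SmoothOnTorus.integrable (hφ : SmoothOnTorus φ) : Integrable φ :=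
  hφ.continuous.integrable_of_hasCompactSupport (HasCompactSupport.of_compactSpace _)

lemma SmoothOnTorus.hasDerivAt (hφ : SmoothOnTorus φ) (i : Fin 2) (p : Torus) (t : ℝ) :
    HasDerivAt (fun t : ℝ => φ (p + toTorus (Pi.single i t)))
      (partialDeriv i φ (p + toTorus (Pi.single i t))) t := by
  have hd : ∀ p : Torus, Differentiable ℝ fun t : ℝ => φ (p + toTorus (Pi.single i t)) := by
    intro p
    obtain ⟨x, rfl⟩ := isOpenQuotientMap_toTorus.surjective p
    simp only [← toTorus_add]
    have h1 : Differentiable ℝ fun t : ℝ => x + Pi.single i t := by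
      refine (differentiable_const x).add ?_
      rw [differentiable_pi]
      intro j
      by_cases h : j = i
      · subst h; simp
      · simp [Pi.single_eq_of_ne h]
    exact (ContDiff.differentiable hφ (by simp)).comp h1
  have h2 := (hd p t).hasDerivAt
  convert! h2 using 1
  unfold partialDeriv
  have := deriv_comp_add_const (fun s : ℝ => φ (p + toTorus (Pi.single i s))) t 0
  rw [zero_add] at this
  rw [← this]
  congr 1
  ext s
  rw [add_assoc, ← toTorus_add, ← Pi.single_add, add_comm t s]

lemma SmoothOnTorus.partialDeriv (hφ : SmoothOnTorus φ) (i : Fin 2) :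
    SmoothOnTorus (partialDeriv i φ) := by
  have h : ∀ x : Fin 2 → ℝ, _root_.partialDeriv i φ (toTorus x) =
      fderiv ℝ (fun x => φ (toTorus x)) x (Pi.single i 1) := by
    intro x
    have h1 := (ContDiff.differentiable hφ (by simp) x).hasFDerivAt
    have h2 : HasDerivAt (fun t : ℝ => x + Pi.single i t) (Pi.single i 1) 0 := by
      refine HasDerivAt.const_add x ?_
      rw [hasDerivAt_pi]
      intro j
      by_cases h : j = i
      · subst h; simpa using! hasDerivAt_id (0 : ℝ)
      · simpa [Pi.single_eq_of_ne h] using hasDerivAt_const (0 : ℝ) (0 : ℝ)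
    have h3 : HasFDerivAt (fun x => φ (toTorus x)) (fderiv ℝ (fun x => φ (toTorus x)) x)
        ((fun t : ℝ => x + Pi.single i t) 0) := by simpa using h1
    have h4 := h3.comp_hasDerivAt (0 : ℝ) h2
    have h5 := hφ.hasDerivAt i (toTorus x) 0
    simp only [← toTorus_add] at h5
    have h6 := h5.unique h4
    simpa using h6
  unfold SmoothOnTorus
  simp only [h]
  have : ContDiff ℝ ∞ (fderiv ℝ fun x => φ (toTorus x)) :=
    ContDiff.fderiv_right (m := ∞) (n := ∞) hφ (by simp)
  exact this.clm_apply contDiff_const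

lemma torusLaplacian_eq_sum_partialDeriv (hφ : SmoothOnTorus φ) :
    torusLaplacian φ = fun p => ∑ i, partialDeriv i (partialDeriv i φ) p := by
  ext p
  refine Finset.sum_congr rfl fun i _ => ?_
  rw [iteratedDeriv_succ, iteratedDeriv_one]
  have : deriv (fun t : ℝ => φ (p + toTorus (Pi.single i t))) =
      fun t => partialDeriv i φ (p + toTorus (Pi.single i t)) := by
    ext t
    exact (hφ.hasDerivAt i p t).deriv
  rw [this, partialDeriv]

lemma SmoothOnTorus.add {ψ : Torus → ℂ} (hφ : SmoothOnTorus φ) (hψ : SmoothOnTorus ψ) :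
    SmoothOnTorus (fun p => φ p + ψ p) := ContDiff.add hφ hψ

lemma SmoothOnTorus.const_mul (c : ℂ) (hφ : SmoothOnTorus φ) :
    SmoothOnTorus (fun p => c * φ p) := ContDiff.mul contDiff_const hφ

lemma SmoothOnTorus.torusLaplacian (hφ : SmoothOnTorus φ) :
    SmoothOnTorus (torusLaplacian φ) := by
  rw [torusLaplacian_eq_sum_partialDeriv hφ]
  simp only [Fin.sum_univ_two]
  exact ((hφ.partialDeriv 0).partialDeriv 0).add ((hφ.partialDeriv 1).partialDeriv 1)

lemma coeff_translate (F : Torus → ℂ) (k : ℤ × ℤ) (q : Torus) :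
    coeff (fun p => F (p + q)) k = chr k q * coeff F k := by
  have h := integral_add_right_eq_self (μ := (volume : Measure Torus))
    (fun p => chr (-k) p * F p) q
  unfold coeff
  rw [← h, ← integral_const_mul]
  congr 1
  ext p
  rw [chr_apply_add, chr_neg k q]
  have : chr k q * conj (chr k q) = 1 := by
    rw [Complex.mul_conj']
    simp [norm_chr]
  linear_combination (-(chr (-k) p) * F (p + q)) * this

/-- No integration by parts: the `k`-th coefficient of a translate by `t` along the `i`-th axis is
`exp (i kᵢ t)` times that of `φ`, and this is differentiated at `t = 0` under the integral sign. -/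
lemma coeff_partialDeriv (hφ : SmoothOnTorus φ) (i : Fin 2) (k : ℤ × ℤ) :
    coeff (partialDeriv i φ) k = Complex.I * freq k i * coeff φ k := by
  have hψ := hφ.partialDeriv i
  obtain ⟨M, hM⟩ := (isCompact_range hψ.continuous).isBounded.exists_norm_le
  have h1 : HasDerivAt (fun t : ℝ => ∫ p, chr (-k) p * φ (p + toTorus (Pi.single i t)))
      (∫ p, chr (-k) p * partialDeriv i φ (p + toTorus (Pi.single i (0 : ℝ)))) 0 := by
    have hcont : ∀ {F : Torus → ℂ} (t : ℝ), Continuous F →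
        Continuous fun p => chr (-k) p * F (p + toTorus (Pi.single i t)) :=
      fun t hF => by fun_prop
    refine (hasDerivAt_integral_of_dominated_loc_of_deriv_le
      (F := fun (t : ℝ) p => chr (-k) p * φ (p + toTorus (Pi.single i t)))
      (F' := fun (t : ℝ) p => chr (-k) p * partialDeriv i φ (p + toTorus (Pi.single i t)))
      (bound := fun _ => M) (s := univ) univ_mem ?_ ?_ ?_ ?_ ?_ ?_).2
    · exact Eventually.of_forall fun t => (hcont t hφ.continuous).aestronglyMeasurable
    · exact (hcont 0 hφ.continuous).integrable_of_hasCompactSupport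
        (HasCompactSupport.of_compactSpace _)
    · exact (hcont 0 hψ.continuous).aestronglyMeasurable
    · refine Eventually.of_forall fun p t _ => ?_
      rw [norm_mul, norm_chr, one_mul]
      exact hM _ (mem_range_self _)
    · exact integrable_const M
    · exact Eventually.of_forall fun p t _ => (hφ.hasDerivAt i p t).const_mul _
  have h2 : HasDerivAt (fun t : ℝ => Complex.exp (Complex.I * freq k i * t) * coeff φ k)
      (Complex.I * freq k i * coeff φ k) 0 := by
    have h3 : HasDerivAt (fun t : ℝ => Complex.I * freq k i * (t : ℂ))
        (Complex.I * freq k i * 1) 0 :=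
      (Complex.ofRealCLM.hasDerivAt (x := (0 : ℝ))).const_mul _
    have h4 := h3.cexp.mul_const (coeff φ k)
    simpa using h4
  have h5 : (fun t : ℝ => ∫ p, chr (-k) p * φ (p + toTorus (Pi.single i t))) =
      fun t : ℝ => Complex.exp (Complex.I * freq k i * t) * coeff φ k := by
    ext t
    rw [← chr_toTorus_single, ← coeff_translate]
    rfl
  rw [h5] at h1
  have h6 := h1.unique h2
  rw [← h6, coeff]
  have : toTorus (Pi.single i (0 : ℝ)) = 0 := by ext j; simp [toTorus]
  simp only [this, add_zero]

lemma coeff_add {F G : Torus → ℂ} (hF : Integrable F) (hG : Integrable G) (k : ℤ × ℤ) :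
    coeff (fun p => F p + G p) k = coeff F k + coeff G k := by
  unfold coeff
  rw [← integral_add (integrable_chr_mul hF _) (integrable_chr_mul hG _)]
  simp only [mul_add]

lemma coeff_const_mul (F : Torus → ℂ) (c : ℂ) (k : ℤ × ℤ) :
    coeff (fun p => c * F p) k = c * coeff F k := by
  unfold coeff
  rw [← integral_const_mul]
  simp only [mul_left_comm]

lemma coeff_torusLaplacian (hφ : SmoothOnTorus φ) (k : ℤ × ℤ) :
    coeff (torusLaplacian φ) k = -(nsq k : ℝ) * coeff φ k := by
  rw [torusLaplacian_eq_sum_partialDeriv hφ]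
  simp only [Fin.sum_univ_two]
  rw [coeff_add (((hφ.partialDeriv 0).partialDeriv 0).integrable)
    (((hφ.partialDeriv 1).partialDeriv 1).integrable)]
  rw [coeff_partialDeriv (hφ.partialDeriv 0), coeff_partialDeriv (hφ.partialDeriv 1),
    coeff_partialDeriv hφ, coeff_partialDeriv hφ, nsq_cast]
  simp only [freq, Matrix.cons_val_zero, Matrix.cons_val_one]
  push_cast
  linear_combination ((k.1 : ℂ) ^ 2 + (k.2 : ℂ) ^ 2) * coeff φ k * Complex.I_sq

end Derivatives

lemma torusLaplacian_chr (k : ℤ × ℤ) (p : Torus) :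
    torusLaplacian (chr k) p = -(nsq k : ℝ) * chr k p := by
  have h : ∀ i, partialDeriv i (chr k) = fun p => Complex.I * freq k i * chr k p := by
    intro i
    ext p
    have h1 : (fun t : ℝ => chr k (p + toTorus (Pi.single i t))) =
        fun t : ℝ => chr k p * Complex.exp (Complex.I * freq k i * t) := by
      ext t
      rw [chr_apply_add, chr_toTorus_single]
    have h3 : HasDerivAt (fun t : ℝ => Complex.I * freq k i * (t : ℂ))
        (Complex.I * freq k i * 1) 0 :=
      (Complex.ofRealCLM.hasDerivAt (x := (0 : ℝ))).const_mul _
    have h4 := h3.cexp.const_mul (chr k p)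
    rw [partialDeriv, h1, h4.deriv]
    simp
    ring
  have h2 : ∀ i (c : ℂ) (p : Torus), partialDeriv i (fun p => c * chr k p) p =
      c * partialDeriv i (chr k) p := by
    intro i c p
    exact deriv_const_mul_field c
  rw [torusLaplacian_eq_sum_partialDeriv (smoothOnTorus_chr k)]
  dsimp only
  rw [Fin.sum_univ_two, h, h, h2, h2,
    h, h, nsq_cast]
  simp only [freq, Matrix.cons_val_zero, Matrix.cons_val_one]
  push_cast
  linear_combination ((k.1 : ℂ) ^ 2 + (k.2 : ℂ) ^ 2) * chr k p * Complex.I_sq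

lemma nsq_neg (k : ℤ × ℤ) : nsq (-k) = nsq k := by simp [nsq]

/-- The eigenvalues of `-Δ` are the sums of two squares. -/
lemma laplaceEigenvalues_eq : laplaceEigenvalues = range fun k => (nsq k : ℝ) := by
  ext lam
  constructor
  · rintro ⟨f, hf, hne, heq⟩
    by_contra hlam
    apply hne
    refine eq_zero_of_coeff_eq_zero hf.continuous fun k => ?_
    have h1 : torusLaplacian f = fun p => -(lam : ℂ) * f p := by
      ext p
      linear_combination -(heq p)
    have h2 := coeff_torusLaplacian hf k
    rw [h1, coeff_const_mul] at h2
    have h3 : ((nsq k : ℝ) - lam : ℂ) * coeff f k = 0 := by linear_combination h2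
    refine (mul_eq_zero.1 h3).resolve_left ?_
    intro h
    exact hlam ⟨k, by exact_mod_cast sub_eq_zero.1 h⟩
  · rintro ⟨k, rfl⟩
    refine ⟨chr k, smoothOnTorus_chr k, ?_, fun p => ?_⟩
    · intro h
      have := norm_chr k 0
      simp [h] at this
    · rw [torusLaplacian_chr]
      simp

/-- Rapid decay of the Fourier coefficients of a smooth function. -/
lemma exists_norm_coeff_mul_pow_le {a : Torus → ℂ} (ha : SmoothOnTorus a) (m : ℕ) :
    ∃ M : ℝ, ∀ k, ‖coeff a k‖ * (1 + (nsq k : ℝ)) ^ m ≤ M := by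
  induction m generalizing a with
  | zero => exact ⟨∫ p, ‖a p‖, fun k => by simpa using norm_coeff_le k⟩
  | succ m ih =>
    -- Each factor `1 + |k|²` is gained by passing to `(1 - Δ) a`, which is again smooth.
    have hb : SmoothOnTorus fun p => a p + (-1) * torusLaplacian a p :=
      ha.add (ha.torusLaplacian.const_mul _)
    obtain ⟨M, hM⟩ := ih hb
    refine ⟨M, fun k => ?_⟩
    have h := hM k
    rw [coeff_add ha.integrable (ha.torusLaplacian.const_mul _).integrable, coeff_const_mul,
      coeff_torusLaplacian ha] at h
    have h2 : coeff a k + -1 * (-((nsq k : ℝ) : ℂ) * coeff a k) =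
        ((1 + (nsq k : ℝ) : ℝ) : ℂ) * coeff a k := by push_cast; ring
    rw [h2, norm_mul, Complex.norm_of_nonneg (by positivity)] at h
    rw [pow_succ]
    linarith

/-- Since `(1 + m²)(1 + n²) ≤ (1 + m² + n²)²`, the double series is dominated by a product of two
one-variable series. -/
lemma summable_one_add_nsq : Summable fun k : ℤ × ℤ => ((1 + (nsq k : ℝ)) ^ 2)⁻¹ := by
  have h1 : Summable fun n : ℤ => (1 + (n : ℝ) ^ 2)⁻¹ := by
    have h2 : Summable fun n : ℤ => 1 / (n : ℝ) ^ 2 :=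
      Real.summable_one_div_int_pow.2 (by norm_num)
    refine Summable.of_norm_bounded_eventually h2 ?_
    rw [Filter.eventually_cofinite]
    refine (Set.finite_singleton (0 : ℤ)).subset fun n hn => ?_
    by_contra h
    apply hn
    have h3 : (n : ℝ) ≠ 0 := by exact_mod_cast h
    have h4 : 0 < (n : ℝ) ^ 2 := by positivity
    rw [Real.norm_of_nonneg (by positivity), one_div]
    exact inv_anti₀ h4 (by linarith)
  have h5 := h1.mul_of_nonneg h1 (fun n => by positivity) (fun n => by positivity)
  refine h5.of_nonneg_of_le (fun k => by positivity) fun k => ?_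
  rw [← mul_inv]
  refine inv_anti₀ (by positivity) ?_
  rw [nsq_cast]
  nlinarith [sq_nonneg (k.1 : ℝ), sq_nonneg (k.2 : ℝ),
    mul_nonneg (sq_nonneg (k.1 : ℝ)) (sq_nonneg (k.2 : ℝ))]

lemma summable_norm_coeff_mul_pow {a : Torus → ℂ} (ha : SmoothOnTorus a) (m : ℕ) :
    Summable fun k => ‖coeff a k‖ * (1 + (nsq k : ℝ)) ^ m := by
  obtain ⟨M, hM⟩ := exists_norm_coeff_mul_pow_le ha (m + 2)
  refine (summable_one_add_nsq.mul_left M).of_nonneg_of_le (fun k => by positivity) fun k => ?_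
  rw [← div_eq_mul_inv, le_div_iff₀ (by positivity), mul_assoc, ← pow_add]
  exact hM k

/-- Fourier coefficients of the Green function. -/
lemma IsGreenFunction.coeff_mul {lam : ℝ} {y : Torus} {G : Torus → ℂ}
    (hG : IsGreenFunction lam y G) (k : ℤ × ℤ) :
    ((lam : ℂ) - (nsq k : ℝ)) * coeff G k = chr (-k) y := by
  rw [← hG.2 _ (smoothOnTorus_chr (-k)), coeff, ← integral_const_mul]
  congr 1
  ext p
  rw [torusLaplacian_chr, nsq_neg]
  ring

/-! ### Representations as sums of two squares -/

/-- The Gaussian integers of norm `n`. -/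
def gaussianOfNorm (n : ℕ) : Set GaussianInt := {z | z.norm = n}

lemma gaussianInt_norm_eq (z : GaussianInt) : z.norm = z.re ^ 2 + z.im ^ 2 := by
  rw [Zsqrtd.norm_def]; ring

lemma finite_gaussianOfNorm (n : ℕ) : (gaussianOfNorm n).Finite := by
  have h : ((Icc (-(n : ℤ)) n) ×ˢ (Icc (-(n : ℤ)) n)).Finite :=
    (Set.finite_Icc _ _).prod (Set.finite_Icc _ _)
  refine (h.image fun k => (⟨k.1, k.2⟩ : GaussianInt)).subset fun z hz => ?_
  have hz' : z.re ^ 2 + z.im ^ 2 = n := by rw [← gaussianInt_norm_eq]; exact hz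
  refine ⟨(z.re, z.im), ⟨⟨?_, ?_⟩, ⟨?_, ?_⟩⟩, rfl⟩ <;>
  nlinarith [sq_nonneg z.re, sq_nonneg z.im, Int.le_self_sq z.re, Int.le_self_sq z.im,
    Int.le_self_sq (-z.re), Int.le_self_sq (-z.im)]

lemma gaussianInt_norm_star (z : GaussianInt) : (star z).norm = z.norm := by
  simp [gaussianInt_norm_eq]

/-- A Gaussian integer of norm `p ^ k * m` is a product of one of `k + 1` fixed elements and an
element of norm `m`. -/
lemma ncard_gaussianOfNorm_prime_pow_mul_le {p : ℕ} (hp : p.Prime) {m : ℕ} (hm : ¬ p ∣ m) (k : ℕ) :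
    (gaussianOfNorm (p ^ k * m)).ncard ≤ (k + 1) * (gaussianOfNorm m).ncard := by
  have hp0 : (p : GaussianInt) ≠ 0 := by exact_mod_cast hp.ne_zero
  have hpu : ¬ IsUnit (p : GaussianInt) := by
    intro h
    rw [Zsqrtd.isUnit_iff_norm_isUnit] at h
    simp only [Zsqrtd.norm_natCast] at h
    have := isUnit_of_mul_isUnit_left h
    exact hp.one_lt.ne' (by simpa using Int.isUnit_iff_natAbs_eq.1 this)
  obtain ⟨q, hq, hqp⟩ := WfDvdMonoid.exists_irreducible_factor hpu hp0
  have hqP : Prime q := hq.prime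
  -- The norm of a prime `q` above `p` divides `p²`, so `e` is `1` or `2`; the rest treats both
  -- cases at once.
  obtain ⟨e, he, hqe⟩ : ∃ e, 1 ≤ e ∧ q.norm = (p : ℤ) ^ e := by
    have h1 : q.norm ∣ (p : ℤ) ^ 2 := by
      obtain ⟨c, hc⟩ := hqp
      refine ⟨c.norm, ?_⟩
      rw [← Zsqrtd.norm_mul, ← hc, Zsqrtd.norm_natCast, sq]
    have h2 : q.norm.natAbs ∣ p ^ 2 := by
      have := Int.natAbs_dvd_natAbs.2 h1
      simpa [Int.natAbs_pow] using this
    obtain ⟨e, -, he⟩ := (Nat.dvd_prime_pow hp).1 h2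
    refine ⟨e, ?_, ?_⟩
    · rcases Nat.eq_zero_or_pos e with rfl | h
      · exact absurd (Zsqrtd.norm_eq_one_iff.1 (by simpa using he)) hq.not_isUnit
      · exact h
    · rw [← GaussianInt.abs_natCast_norm, he]; push_cast; rfl
  have hpe : (0 : ℤ) < (p : ℤ) ^ e := by have := hp.pos; positivity
  -- As `q` divides `p`, which divides `z * star z`, primality lets one factor `q` or `star q` be
  -- peeled off `z`; then induct on the exponent of `p`.
  have hdec : ∀ k, ∀ z ∈ gaussianOfNorm (p ^ k * m),
      ∃ i ≤ k, ∃ j, ∃ w ∈ gaussianOfNorm m, z = q ^ i * star q ^ j * w ∧ e * (i + j) = k := by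
    intro k
    induction k using Nat.strong_induction_on with
    | _ k ih =>
      intro z hz
      rcases Nat.eq_zero_or_pos k with rfl | hk
      · exact ⟨0, le_rfl, 0, z, by simpa using hz, by simp, by simp⟩
      have hz' : z.norm = (p : ℤ) ^ k * m := by
        have : z.norm = ((p ^ k * m : ℕ) : ℤ) := hz
        rw [this]; push_cast; rfl
      have hdiv : q ∣ z * star z := by
        rw [← Zsqrtd.norm_eq_mul_conj, hz']
        refine hqp.trans ⟨(p : GaussianInt) ^ (k - 1) * m, ?_⟩
        push_cast
        rw [← mul_assoc, ← pow_succ', Nat.sub_add_cancel hk]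
      have hsplit : ∃ z', z = q * z' ∨ z = star q * z' := by
        rcases hqP.dvd_or_dvd hdiv with ⟨c, hc⟩ | ⟨c, hc⟩
        · exact ⟨c, Or.inl hc⟩
        · refine ⟨star c, Or.inr ?_⟩
          rw [← star_star z, hc, star_mul, mul_comm]
      obtain ⟨z', hz2⟩ := hsplit
      have hn : (p : ℤ) ^ e * z'.norm = (p : ℤ) ^ k * m := by
        rw [← hz']
        rcases hz2 with h | h <;> rw [h, Zsqrtd.norm_mul]
        · rw [hqe]
        · rw [gaussianInt_norm_star, hqe]
      have hek : e ≤ k := by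
        by_contra! hlt
        apply hm
        have h1 : (p : ℤ) ^ k * (p ^ (e - k) * z'.norm) = (p : ℤ) ^ k * m := by
          rw [← mul_assoc, ← pow_add, Nat.add_sub_cancel' hlt.le, hn]
        have h2 := mul_left_cancel₀ (by have := hp.pos; positivity) h1
        have h3 : (p : ℤ) ∣ m := by
          rw [← h2]
          exact Dvd.dvd.mul_right (dvd_pow_self _ (by omega)) _
        exact_mod_cast h3
      have hz3 : z' ∈ gaussianOfNorm (p ^ (k - e) * m) := by
        have h1 : (p : ℤ) ^ e * z'.norm = (p : ℤ) ^ e * ((p ^ (k - e) * m : ℕ) : ℤ) := by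
          push_cast
          rw [hn, ← mul_assoc, ← pow_add, Nat.add_sub_cancel' hek]
        exact mul_left_cancel₀ hpe.ne' h1
      obtain ⟨i, hi, j, w, hw, hzw, hij⟩ := ih (k - e) (by omega) z' hz3
      have hsum : e * (i + j + 1) = k := by rw [mul_add, hij]; omega
      rcases hz2 with h | h
      · exact ⟨i + 1, by omega, j, w, hw, by rw [h, hzw]; ring, by rw [← hsum]; ring⟩
      · exact ⟨i, by omega, j + 1, w, hw, by rw [h, hzw]; ring, by rw [← hsum]; ring⟩
  -- The relation `e * (i + j) = k` determines `j` from `i`, which leaves only `k + 1` possible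
  -- prefactors.
  have hsub : gaussianOfNorm (p ^ k * m) ⊆ ⋃ i ∈ Finset.range (k + 1),
      (fun w => q ^ i * star q ^ (k / e - i) * w) '' gaussianOfNorm m := by
    intro z hz
    obtain ⟨i, hi, j, w, hw, hzw, hij⟩ := hdec k z hz
    simp only [mem_iUnion]
    refine ⟨i, Finset.mem_range.2 (by omega), w, hw, ?_⟩
    have : k / e - i = j := by
      rw [← hij, Nat.mul_div_cancel_left _ (by omega)]; omega
    dsimp only
    rw [this, hzw]
  calc _ ≤ _ := Set.ncard_le_ncard hsub
          ((Finset.range (k + 1)).finite_toSet.biUnion fun i _ =>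
            (finite_gaussianOfNorm m).image _)
    _ ≤ ∑ i ∈ Finset.range (k + 1),
          ((fun w => q ^ i * star q ^ (k / e - i) * w) '' gaussianOfNorm m).ncard :=
        Finset.set_ncard_biUnion_le _ _
    _ ≤ ∑ i ∈ Finset.range (k + 1), (gaussianOfNorm m).ncard :=
        Finset.sum_le_sum fun i _ => Set.ncard_image_le (finite_gaussianOfNorm m)
    _ = _ := by simp

lemma one_add_half_le_two_rpow {x : ℝ} (hx : 0 ≤ x) : 1 + x / 2 ≤ (2 : ℝ) ^ x := by
  rw [Real.rpow_def_of_pos two_pos]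
  have h1 := Real.add_one_le_exp (Real.log 2 * x)
  have h2 := Real.log_two_gt_d9
  nlinarith

/-- The number of representations of `n` as a sum of two squares is `O(n ^ δ)`. -/
lemma exists_ncard_gaussianOfNorm_le {δ : ℝ} (hδ : 0 < δ) :
    ∃ C : ℝ, 0 < C ∧ ∀ n : ℕ, n ≠ 0 → ((gaussianOfNorm n).ncard : ℝ) ≤ C * (n : ℝ) ^ δ := by
  -- A prime `p ≥ Y` has `p ^ δ ≥ 2`, so its factor `k + 1 ≤ 2 ^ k` is paid for by `p ^ (k δ)`. A
  -- prime below `Y` costs an extra factor `B`, and at most `Y` of these occur; `B` is chosen so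
  -- that `k + 1 ≤ B * 2 ^ (k δ)` for all `k`.
  set B : ℝ := 1 + 2 / δ with hB
  have hB1 : 1 ≤ B := by
    rw [hB]
    have : 0 < 2 / δ := by positivity
    linarith
  have hBk : ∀ k : ℕ, (k : ℝ) + 1 ≤ B * (2 : ℝ) ^ (k * δ) := by
    intro k
    have h1 : 1 + (k * δ) / 2 ≤ (2 : ℝ) ^ (k * δ) :=
      one_add_half_le_two_rpow (by positivity)
    calc (k : ℝ) + 1 ≤ B * (1 + (k * δ) / 2) := by
          rw [hB]
          have : (1 + 2 / δ) * (1 + k * δ / 2) = 1 + k * δ / 2 + 2 / δ + k := by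
            field_simp
            ring
          rw [this]
          have : 0 ≤ k * δ / 2 + 2 / δ := by positivity
          linarith
      _ ≤ _ := by gcongr
  obtain ⟨Y, hY⟩ : ∃ Y : ℕ, ∀ p : ℕ, Y ≤ p → (2 : ℝ) ≤ (p : ℝ) ^ δ := by
    have h := (tendsto_rpow_atTop hδ).comp (tendsto_natCast_atTop_atTop (R := ℝ))
    obtain ⟨Y, hY⟩ := eventually_atTop.1 (h.eventually_ge_atTop 2)
    exact ⟨Y, hY⟩
  set A : ℝ := ((gaussianOfNorm 1).ncard : ℝ) with hA
  have key : ∀ n : ℕ, n ≠ 0 → ((gaussianOfNorm n).ncard : ℝ) ≤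
      A * B ^ ((Finset.range Y).filter fun p => p ∣ n).card * (n : ℝ) ^ δ := by
    intro n
    induction n using Nat.recOnPrimePow with
    | zero => intro h; exact absurd rfl h
    | one =>
      intro _
      rw [Nat.cast_one, one_rpow, mul_one, ← hA]
      exact le_mul_of_one_le_right (by positivity) (one_le_pow₀ hB1)
    | prime_pow_mul a p k hp hpa hk ih =>
      intro h0
      have ha : a ≠ 0 := by rintro rfl; simp at h0
      have ih := ih ha
      have h1 : ((gaussianOfNorm (p ^ k * a)).ncard : ℝ) ≤ (k + 1) * (gaussianOfNorm a).ncard := by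
        exact_mod_cast ncard_gaussianOfNorm_prime_pow_mul_le hp hpa k
      set s := (Finset.range Y).filter fun q => q ∣ a with hs
      set t := (Finset.range Y).filter fun q => q ∣ p ^ k * a with ht
      have hst : s ⊆ t := by
        intro q hq
        rw [hs, Finset.mem_filter] at hq
        rw [ht, Finset.mem_filter]
        exact ⟨hq.1, hq.2.mul_left _⟩
      have h2 : ((k : ℝ) + 1) * B ^ s.card ≤ B ^ t.card * ((p : ℝ) ^ δ) ^ k := by
        rcases le_or_gt Y p with hYp | hYp
        · have h3 : B ^ s.card ≤ B ^ t.card :=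
            pow_le_pow_right₀ hB1 (Finset.card_le_card hst)
          have h4 : (k : ℝ) + 1 ≤ ((p : ℝ) ^ δ) ^ k := by
            calc (k : ℝ) + 1 ≤ 2 ^ k := by exact_mod_cast Nat.lt_two_pow_self
              _ ≤ _ := by gcongr; exact hY p hYp
          rw [mul_comm]
          gcongr
        · have h3 : s.card + 1 ≤ t.card := by
            have hps : p ∉ s := by simp [hs, hpa]
            rw [← Finset.card_insert_of_notMem hps]
            refine Finset.card_le_card (Finset.insert_subset ?_ hst)
            rw [ht, Finset.mem_filter, Finset.mem_range]
            exact ⟨hYp, (dvd_pow_self p hk.ne').mul_right a⟩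
          have h4 : (k : ℝ) + 1 ≤ B * ((p : ℝ) ^ δ) ^ k := by
            refine (hBk k).trans ?_
            rw [← Real.rpow_natCast ((p : ℝ) ^ δ), ← Real.rpow_mul (by positivity), mul_comm δ]
            gcongr
            exact_mod_cast hp.two_le
          calc ((k : ℝ) + 1) * B ^ s.card ≤ (B * ((p : ℝ) ^ δ) ^ k) * B ^ s.card := by gcongr
            _ = B ^ (s.card + 1) * ((p : ℝ) ^ δ) ^ k := by ring
            _ ≤ _ := by gcongr
      have h5 : ((p ^ k * a : ℕ) : ℝ) ^ δ = ((p : ℝ) ^ δ) ^ k * (a : ℝ) ^ δ := by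
        push_cast
        rw [Real.mul_rpow (by positivity) (by positivity), ← Real.rpow_natCast (p : ℝ),
          ← Real.rpow_natCast ((p : ℝ) ^ δ), ← Real.rpow_mul (by positivity),
          ← Real.rpow_mul (by positivity), mul_comm δ]
      calc _ ≤ ((k : ℝ) + 1) * (gaussianOfNorm a).ncard := h1
        _ ≤ ((k : ℝ) + 1) * (A * B ^ s.card * (a : ℝ) ^ δ) := by gcongr
        _ = A * (((k : ℝ) + 1) * B ^ s.card) * (a : ℝ) ^ δ := by ring
        _ ≤ A * (B ^ t.card * ((p : ℝ) ^ δ) ^ k) * (a : ℝ) ^ δ := by gcongr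
        _ = _ := by rw [h5]; ring
  refine ⟨(A + 1) * B ^ Y, by positivity, fun n hn => (key n hn).trans ?_⟩
  gcongr
  · linarith
  · exact (Finset.card_filter_le _ _).trans (by simp)

lemma setOf_nsq_eq (n : ℕ) : {k : ℤ × ℤ | nsq k = n} =
    (fun z : GaussianInt => (z.re, z.im)) '' gaussianOfNorm n := by
  ext k
  have h : ∀ k : ℤ × ℤ, nsq k = n ↔ k.1 ^ 2 + k.2 ^ 2 = (n : ℤ) := by
    intro k
    rw [← Int.natCast_inj]
    simp [nsq]
  simp only [mem_ofPred_eq, h, mem_image, gaussianOfNorm, gaussianInt_norm_eq]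
  constructor
  · intro hk
    exact ⟨⟨k.1, k.2⟩, hk, rfl⟩
  · rintro ⟨z, hz, rfl⟩
    exact hz

lemma finite_nsq_eq (n : ℕ) : {k : ℤ × ℤ | nsq k = n}.Finite := by
  rw [setOf_nsq_eq]
  exact (finite_gaussianOfNorm n).image _

lemma exists_ncard_nsq_eq_le {δ : ℝ} (hδ : 0 < δ) :
    ∃ C : ℝ, 0 < C ∧ ∀ n : ℕ, ({k : ℤ × ℤ | nsq k = n}.ncard : ℝ) ≤ C * (1 + n : ℝ) ^ δ := by
  obtain ⟨C, hC, h⟩ := exists_ncard_gaussianOfNorm_le hδ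
  refine ⟨C + (gaussianOfNorm 0).ncard, by positivity, fun n => ?_⟩
  have h1 : ({k : ℤ × ℤ | nsq k = n}.ncard : ℝ) ≤ (gaussianOfNorm n).ncard := by
    rw [setOf_nsq_eq]
    exact_mod_cast Set.ncard_image_le (finite_gaussianOfNorm n)
  refine h1.trans ?_
  rcases eq_or_ne n 0 with rfl | hn
  · simp [hC.le]
  · calc ((gaussianOfNorm n).ncard : ℝ) ≤ C * (n : ℝ) ^ δ := h n hn
      _ ≤ _ := by gcongr <;> simp

/-! ### Counting across weakly interlacing sets -/

section Interlacing

variable {A B : Set ℝ}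

lemma exists_next (hfin : ∀ X, (A ∩ Icc 0 X).Finite) (hunb : ∀ X, ∃ a ∈ A, X < a) {s : ℝ}
    (hs : 0 ≤ s) : ∃ t ∈ A, s < t ∧ Ioo s t ∩ A = ∅ := by
  obtain ⟨a, ha, hsa⟩ := hunb s
  have hf : (A ∩ Ioc s a).Finite := (hfin a).subset fun x hx =>
    ⟨hx.1, hs.trans hx.2.1.le, hx.2.2⟩
  obtain ⟨t, ht, hmin⟩ := hf.exists_minimal ⟨a, ha, hsa, le_rfl⟩
  refine ⟨t, ht.1, ht.2.1, ?_⟩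
  rw [eq_empty_iff_forall_notMem]
  rintro x ⟨hx, hxA⟩
  exact absurd (hmin ⟨hxA, hx.1, hx.2.le.trans ht.2.2⟩ hx.2.le) (not_le.2 hx.2)

lemma exists_prev (hfin : ∀ X, (A ∩ Icc 0 X).Finite) {t b : ℝ} (ht : t ∈ A) (ht0 : 0 ≤ t)
    (htb : t ≤ b) : ∃ s ∈ A, t ≤ s ∧ s ≤ b ∧ ∀ a ∈ A, a ≤ b → a ≤ s := by
  have hf : (A ∩ Icc t b).Finite := (hfin b).subset fun x hx =>
    ⟨hx.1, ht0.trans hx.2.1, hx.2.2⟩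
  obtain ⟨s, hs, hmax⟩ := hf.exists_maximal ⟨t, ht, le_rfl, htb⟩
  refine ⟨s, hs.1, hs.2.1, hs.2.2, fun a ha hab => ?_⟩
  by_contra! h
  exact absurd (hmax ⟨ha, hs.2.1.trans h.le, hab⟩ h.le) (not_le.2 h)

/-- The elements of `B` whose predecessor in `A` belongs to a finite set `S`. -/
def succInterval (A B : Set ℝ) (S : Finset ℝ) : Set ℝ :=
  {b | b ∈ B ∧ ∃ s ∈ S, s ≤ b ∧ ∀ a ∈ A, a ≤ b → a ≤ s}

/-- An element of `B` whose predecessor in `A` is `s` lies strictly between `s` and the next element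
of `A`, disjointness excluding `s` itself; so each `s` accounts for at most `C` elements. -/
lemma encard_succInterval_le {C : ℕ} (hAB : A ∩ B = ∅) (h : AtMostBetweenConsecutive C A B)
    (hfin : ∀ X, (A ∩ Icc 0 X).Finite) (hunb : ∀ X, ∃ a ∈ A, X < a)
    (S : Finset ℝ) (hS : ∀ s ∈ S, s ∈ A ∧ 0 ≤ s) :
    (succInterval A B S).encard ≤ ((C * S.card : ℕ) : ℕ∞) := by
  have hnext : ∀ s ∈ S, (B ∩ {b | s ≤ b ∧ ∀ a ∈ A, a ≤ b → a ≤ s}).encard ≤ C := by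
    intro s hs
    obtain ⟨t, htA, hst, hem⟩ := exists_next hfin hunb (hS s hs).2
    refine le_trans (encard_le_encard ?_) (h s (hS s hs).1 t htA hst hem)
    rintro b ⟨hb, hsb, hmax⟩
    refine ⟨⟨lt_of_le_of_ne hsb ?_, ?_⟩, hb⟩
    · rintro rfl
      exact eq_empty_iff_forall_notMem.1 hAB s ⟨(hS s hs).1, hb⟩
    · by_contra! htb
      exact absurd (hmax t htA htb) (not_le.2 hst)
  have hsub : succInterval A B S ⊆ ⋃ s ∈ S, (B ∩ {b | s ≤ b ∧ ∀ a ∈ A, a ≤ b → a ≤ s}) := by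
    rintro b ⟨hb, s, hs, h1⟩
    simp only [mem_iUnion]
    exact ⟨s, hs, hb, h1⟩
  refine (encard_le_encard hsub).trans ?_
  clear hsub
  have : ∀ S' : Finset ℝ, S' ⊆ S →
      (⋃ s ∈ S', (B ∩ {b | s ≤ b ∧ ∀ a ∈ A, a ≤ b → a ≤ s})).encard
        ≤ ((C * S'.card : ℕ) : ℕ∞) := by
    intro S'
    induction S' using Finset.induction_on with
    | empty => simp
    | insert s S' hs ih =>
      intro hsub
      rw [Finset.set_biUnion_insert, Finset.card_insert_of_notMem hs]
      refine (encard_union_le _ _).trans ?_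
      have h1 := hnext s (hsub (Finset.mem_insert_self _ _))
      have h2 := ih ((Finset.subset_insert _ _).trans hsub)
      refine (add_le_add h1 h2).trans ?_
      rw [← Nat.cast_add]
      exact_mod_cast (by ring_nf; rfl)
  exact this S subset_rfl

end Interlacing

/-! ### Diophantine vectors and resonant eigenvalues -/

/-- A separated finite set of naturals in `[0, N]` is small. -/
lemma card_le_of_separated {s : Finset ℕ} {N H : ℝ} (hN : 0 ≤ N) (hH : 0 < H)
    (hs : ∀ x ∈ s, (x : ℝ) ≤ N) (hsep : ∀ x ∈ s, ∀ y ∈ s, x < y → H ≤ (y : ℝ) - x) :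
    (s.card : ℝ) ≤ N / H + 1 := by
  have hlt : ∀ x ∈ s, ∀ y ∈ s, x < y → ⌊(x : ℝ) / H⌋₊ < ⌊(y : ℝ) / H⌋₊ := by
    intro x hx y hy hxy
    have h1 := hsep x hx y hy hxy
    have h2 : (x : ℝ) / H + 1 ≤ y / H := by
      rw [div_add_one hH.ne', div_le_div_iff_of_pos_right hH]
      linarith
    have h3 := Nat.floor_le_floor h2
    rw [Nat.floor_add_one (by positivity)] at h3
    omega
  have hinj : Set.InjOn (fun x : ℕ => ⌊(x : ℝ) / H⌋₊) s := by
    intro x hx y hy hxy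
    rcases lt_trichotomy x y with h | h | h
    · exact absurd hxy (hlt x hx y hy h).ne
    · exact h
    · exact absurd hxy (hlt y hy x hx h).ne'
  have hmap : ∀ x ∈ s, ⌊(x : ℝ) / H⌋₊ ∈ Finset.range (⌊N / H⌋₊ + 1) := by
    intro x hx
    rw [Finset.mem_range, Nat.lt_succ_iff]
    exact Nat.floor_le_floor (by gcongr; exact hs x hx)
  have h4 := Finset.card_le_card_of_injOn _ hmap hinj
  rw [Finset.card_range] at h4
  calc (s.card : ℝ) ≤ ((⌊N / H⌋₊ + 1 : ℕ) : ℝ) := by exact_mod_cast h4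
    _ ≤ N / H + 1 := by
      push_cast
      gcongr
      exact Nat.floor_le (by positivity)

/-- Jordan's inequality after removing the nearest integer; it converts small sines into good
rational approximations. -/
lemma two_mul_abs_sub_round_le (y : ℝ) : 2 * |y - round y| ≤ |sin (π * y)| := by
  have h1 : |π * (y - round y)| ≤ π / 2 := by
    rw [abs_mul, abs_of_pos pi_pos]
    have := abs_sub_round y
    nlinarith [pi_pos]
  have h2 := Real.mul_abs_le_abs_sin h1
  have h3 : |sin (π * (y - round y))| = |sin (π * y)| := by
    rw [mul_sub, mul_comm π (round y : ℝ), Real.sin_sub_int_mul_pi, abs_mul]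
    simp
  rw [h3, abs_mul, abs_of_pos pi_pos] at h2
  calc _ = 2 / π * (π * |y - round y|) := by field_simp
    _ ≤ _ := h2

/-- A positive integer `m` that brings both coordinates of a Diophantine vector close to integers
has to be large. -/
lemma IsDiophantine.exists_le_of_abs_sin_lt {x₀ : Fin 2 → ℝ}
    (h : IsDiophantine fun i => x₀ i / π) :
    ∃ τ c : ℝ, 0 < τ ∧ τ ≤ 1 ∧ 0 < c ∧ ∀ η : ℝ, 0 < η → ∀ m : ℕ, 0 < m →
      (∀ i, |sin (m * x₀ i)| < η) → c * η ^ (-τ) ≤ m := by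
  obtain ⟨κ, C, hC, hd⟩ := h
  -- The approximation error carries a factor `1 / m`, which cancels one power of the denominator
  -- and leaves `κ - 1`; the maximum with `1` keeps the exponent positive and gives `τ = 1 / κ' ≤
  -- 1`.
  set κ' := max (κ - 1) 1 with hκ'
  have hκ1 : 1 ≤ κ' := le_max_right _ _
  have hκ0 : 0 < κ' := by linarith
  refine ⟨1 / κ', (2 * C) ^ (1 / κ'), by positivity, ?_, by positivity, ?_⟩
  · rw [div_le_one hκ0]; exact hκ1
  intro η hη m hm hsin
  have hm1 : (1 : ℝ) ≤ m := by exact_mod_cast hm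
  have hm0 : (0 : ℝ) < m := by linarith
  have happ : ∀ i, |x₀ i / π - (round (m * (x₀ i / π)) : ℝ) / m| < η / 2 / m := by
    intro i
    have h1 := two_mul_abs_sub_round_le (m * (x₀ i / π))
    have h2 : π * (m * (x₀ i / π)) = m * x₀ i := by field_simp
    rw [h2] at h1
    have h3 : |x₀ i / π - (round (m * (x₀ i / π)) : ℝ) / m| =
        |m * (x₀ i / π) - (round (m * (x₀ i / π)) : ℝ)| / m := by
      rw [← abs_of_pos hm0, ← abs_div, abs_of_pos hm0]
      congr 1
      field_simp
    rw [h3]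
    gcongr
    linarith [hsin i]
  have h1 := hd (round (m * (x₀ 0 / π))) (round (m * (x₀ 1 / π))) m (by exact_mod_cast hm)
  simp only [Int.cast_natCast] at h1
  have h2 := h1.trans (max_lt (happ 0) (happ 1))
  have h3 : 2 * C / η ≤ (m : ℝ) ^ κ' := by
    have h4 : (m : ℝ) ^ κ ≤ (m : ℝ) ^ κ' * m := by
      rw [← Real.rpow_add_one hm0.ne']
      apply Real.rpow_le_rpow_of_exponent_le hm1
      have := le_max_left (κ - 1) 1
      linarith
    have h5 : 0 < (m : ℝ) ^ κ := by positivity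
    rw [div_lt_div_iff₀ h5 hm0] at h2
    rw [div_le_iff₀ hη]
    have h6 : C * m < η / 2 * ((m : ℝ) ^ κ' * m) := h2.trans_le (by gcongr)
    have h7 : C < η / 2 * (m : ℝ) ^ κ' := by
      rw [← mul_assoc] at h6
      exact lt_of_mul_lt_mul_right h6 hm0.le
    linarith
  have h8 := Real.rpow_le_rpow (by positivity) h3 (by positivity : 0 ≤ 1 / κ')
  rw [← Real.rpow_mul hm0.le, mul_one_div_cancel hκ0.ne', Real.rpow_one,
    Real.div_rpow (by positivity) hη.le] at h8
  rw [Real.rpow_neg hη.le, ← div_eq_mul_inv]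
  exact h8

/-- `k · x`. -/
def dot (k : ℤ × ℤ) (x : Fin 2 → ℝ) : ℝ := k.1 * x 0 + k.2 * x 1

/-- All lattice points `k` with `|k|² = n` have `k · x` close to `π ℤ`. -/
def IsResonant (x : Fin 2 → ℝ) (η : ℝ) (n : ℕ) : Prop :=
  ∀ k : ℤ × ℤ, nsq k = n → |sin (dot k x)| < η

lemma abs_sin_add_le (x y : ℝ) : |sin (x + y)| ≤ |sin x| + |sin y| := by
  rw [Real.sin_add]
  refine (abs_add_le _ _).trans ?_
  rw [abs_mul, abs_mul]
  have h1 := Real.abs_cos_le_one x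
  have h2 := Real.abs_cos_le_one y
  have h3 := abs_nonneg (sin x)
  have h4 := abs_nonneg (sin y)
  nlinarith

lemma abs_sin_sub_le (x y : ℝ) : |sin (x - y)| ≤ |sin x| + |sin y| := by
  have := abs_sin_add_le x (-y)
  rwa [← sub_eq_add_neg, Real.sin_neg, abs_neg] at this

/-- Reflected points on the same circle add up to axis vectors: `(a, b) + (a, -b) = (2a, 0)` and
`(b, a) + (-b, a) = (0, 2a)`. -/
lemma IsResonant.abs_sin_lt {x : Fin 2 → ℝ} {η : ℝ} {a b : ℕ}
    (h : IsResonant x η (a ^ 2 + b ^ 2)) (i : Fin 2) : |sin (2 * a * x i)| < 2 * η := by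
  have key : ∀ k l : ℤ × ℤ, nsq k = a ^ 2 + b ^ 2 → nsq l = a ^ 2 + b ^ 2 →
      dot k x + dot l x = 2 * a * x i → |sin (2 * a * x i)| < 2 * η := by
    intro k l hk hl hsum
    rw [← hsum]
    linarith [abs_sin_add_le (dot k x) (dot l x), h k hk, h l hl]
  fin_cases i
  · refine key (a, b) (a, -b) (by simp [nsq]) (by simp [nsq]) ?_
    simp [dot]; ring
  · refine key (b, a) (-b, a) (by simp [nsq, add_comm]) (by simp [nsq, add_comm]) ?_
    simp [dot]; ring

lemma exists_nat_of_nsq (k : ℤ × ℤ) : ∃ a b : ℕ, nsq k = a ^ 2 + b ^ 2 := ⟨_, _, rfl⟩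

/-- There are few resonant eigenvalues. -/
lemma exists_card_isResonant_le {x₀ : Fin 2 → ℝ} (h : IsDiophantine fun i => x₀ i / π) :
    ∃ τ K : ℝ, 0 < τ ∧ τ ≤ 1 ∧ 0 < K ∧ ∀ η : ℝ, 0 < η → ∀ N : ℝ, 1 ≤ N → ∀ s : Finset ℕ,
      (∀ n ∈ s, (n : ℝ) ≤ N ∧ n ∈ range nsq ∧ IsResonant x₀ η n) →
        (s.card : ℝ) ≤ K * (N * η ^ τ + √N) := by
  classical
  obtain ⟨τ, c, hτ, hτ1, hc, hm⟩ := h.exists_le_of_abs_sin_lt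
  refine ⟨τ, 2 * (2 / c * 4 ^ τ + 1), hτ, hτ1, by positivity, ?_⟩
  intro η hη N hN s hs
  set W := ⌊√N⌋₊ with hW
  have hN1 : 1 ≤ √N := Real.one_le_sqrt.2 hN
  -- Only the first entry `a` of a representation `a² + b²` is constrained by resonance; `b` is left
  -- free at a cost of `√N`.
  set S := (Finset.range (W + 1)).filter fun a : ℕ => ∀ i, |sin (2 * a * x₀ i)| < 2 * η with hS
  have hsub : s ⊆ (S ×ˢ Finset.range (W + 1)).image fun k => k.1 ^ 2 + k.2 ^ 2 := by
    intro n hn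
    obtain ⟨hnN, ⟨k, rfl⟩, hres⟩ := hs n hn
    obtain ⟨a, b, hab⟩ := exists_nat_of_nsq k
    rw [hab] at hnN hres ⊢
    push_cast at hnN
    rw [Finset.mem_image]
    refine ⟨(a, b), ?_, rfl⟩
    have hle : ∀ c : ℕ, (c : ℝ) ^ 2 ≤ N → c ∈ Finset.range (W + 1) := by
      intro c hc
      rw [Finset.mem_range, Nat.lt_succ_iff]
      exact Nat.le_floor (Real.le_sqrt_of_sq_le hc)
    rw [Finset.mem_product, hS, Finset.mem_filter]
    refine ⟨⟨hle _ ?_, fun i => hres.abs_sin_lt i⟩, hle _ ?_⟩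
    · nlinarith [sq_nonneg (b : ℝ)]
    · nlinarith [sq_nonneg (a : ℝ)]
  -- For two elements of `S` the sines at twice their difference are below `4 * η`, so the
  -- Diophantine bound applies to twice the difference; hence the factor `c / 2`.
  set H : ℝ := c / 2 * (4 * η) ^ (-τ) with hH
  have hH0 : 0 < H := by positivity
  have hScard : (S.card : ℝ) ≤ √N / H + 1 := by
    refine card_le_of_separated (by positivity) hH0 ?_ ?_
    · intro a ha
      rw [hS, Finset.mem_filter, Finset.mem_range, Nat.lt_succ_iff] at ha
      exact (Nat.le_floor_iff (by positivity)).1 ha.1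
    · intro a ha b hb hab
      rw [hS, Finset.mem_filter] at ha hb
      have h1 := hm (4 * η) (by positivity) (2 * (b - a)) (by omega) ?_
      · push_cast [Nat.cast_sub hab.le] at h1
        rw [hH]
        linarith
      · intro i
        push_cast [Nat.cast_sub hab.le]
        have : 2 * ((b : ℝ) - a) * x₀ i = 2 * b * x₀ i - 2 * a * x₀ i := by ring
        rw [this]
        linarith [abs_sin_sub_le (2 * b * x₀ i) (2 * a * x₀ i), ha.2 i, hb.2 i]
  have hHinv : √N / H = 2 / c * 4 ^ τ * (√N * η ^ τ) := by
    rw [hH, Real.rpow_neg (by positivity), Real.mul_rpow (by positivity) hη.le]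
    field_simp
  have hcard : (s.card : ℝ) ≤ S.card * (W + 1) := by
    have h1 := (Finset.card_le_card hsub).trans Finset.card_image_le
    rw [Finset.card_product, Finset.card_range] at h1
    exact_mod_cast h1
  have hW1 : (W : ℝ) + 1 ≤ 2 * √N := by
    have := Nat.floor_le (Real.sqrt_nonneg N)
    linarith
  have hsq : √N * √N = N := Real.mul_self_sqrt (by linarith)
  set D := 2 / c * (4 : ℝ) ^ τ with hD
  have hD0 : 0 < D := by positivity
  calc (s.card : ℝ) ≤ S.card * (W + 1) := hcard
    _ ≤ (D * (√N * η ^ τ) + 1) * (2 * √N) := by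
      rw [hHinv] at hScard
      gcongr
    _ = 2 * D * ((√N * √N) * η ^ τ) + 2 * √N := by ring
    _ = 2 * D * (N * η ^ τ) + 2 * √N := by rw [hsq]
    _ ≤ 2 * (D + 1) * (N * η ^ τ + √N) := by
      have : 0 ≤ N * η ^ τ := by positivity
      have : 0 ≤ D * √N := by positivity
      nlinarith

/-! ### Lattice points in strips and a lower bound for sums of two squares -/

/-- The lattice points in a box and a strip orthogonal to `l`. -/
lemma card_strip_le {l : ℤ × ℤ} (hl : l ≠ 0) (W M : ℕ) (s : Finset (ℤ × ℤ))
    (hs : ∀ k ∈ s, k.1.natAbs ≤ W ∧ k.2.natAbs ≤ W ∧ |(nsq (k + l) : ℤ) - nsq k| ≤ M) :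
    s.card ≤ (2 * W + 1) * (2 * M + 1) := by
  classical
  -- The difference is affine in `k` with linear part `2 l·k`. Where a coordinate of `l` is nonzero,
  -- its value and the other coordinate of `k` therefore determine `k`.
  have hform : ∀ k, (nsq (k + l) : ℤ) - nsq k =
      2 * (l.1 * k.1 + l.2 * k.2) + l.1 ^ 2 + l.2 ^ 2 := by
    intro k
    simp [nsq]
    ring
  have hcard : ∀ f : ℤ × ℤ → ℤ, (∀ k ∈ s, (f k).natAbs ≤ W) →
      Set.InjOn (fun k => (f k, (nsq (k + l) : ℤ) - nsq k)) s →
      s.card ≤ (2 * W + 1) * (2 * M + 1) := by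
    intro f hf hinj
    have hmap : ∀ k ∈ s, (f k, (nsq (k + l) : ℤ) - nsq k) ∈
        Finset.Icc (-(W : ℤ)) W ×ˢ Finset.Icc (-(M : ℤ)) M := by
      intro k hk
      rw [Finset.mem_product, Finset.mem_Icc, Finset.mem_Icc]
      have h1 := hf k hk
      have h2 := abs_le.1 (hs k hk).2.2
      exact ⟨⟨by omega, by omega⟩, h2⟩
    have h := Finset.card_le_card_of_injOn _ hmap hinj
    rw [Finset.card_product, Int.card_Icc, Int.card_Icc] at h
    convert h using 2 <;> omega
  by_cases h1 : l.1 = 0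
  · have h2 : l.2 ≠ 0 := fun h => hl (Prod.ext h1 h)
    refine hcard Prod.fst (fun k hk => (hs k hk).1) fun k hk k' hk' h => ?_
    simp only [Prod.mk.injEq, hform] at h
    refine Prod.ext h.1 ?_
    have h3 : l.2 * k.2 = l.2 * k'.2 := by rw [h.1] at h; linarith [h.2]
    exact mul_left_cancel₀ h2 h3
  · refine hcard Prod.snd (fun k hk => (hs k hk).2.1) fun k hk k' hk' h => ?_
    simp only [Prod.mk.injEq, hform] at h
    refine Prod.ext ?_ h.1
    have h3 : l.1 * k.1 = l.1 * k'.1 := by rw [h.1] at h; linarith [h.2]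
    exact mul_left_cancel₀ h1 h3

/-- The number of sums of two squares up to `X` is `≫ X ^ (1 - δ)`. -/
lemma exists_le_ncard_sumSq {δ : ℝ} (hδ : 0 < δ) :
    ∃ c : ℝ, 0 < c ∧ ∀ X : ℝ, 1 ≤ X →
      c * X ^ (1 - δ) ≤ ((range nsq ∩ {n : ℕ | (n : ℝ) ≤ X}).ncard : ℝ) := by
  classical
  obtain ⟨C, hC, hr⟩ := exists_ncard_nsq_eq_le hδ
  refine ⟨1 / (2 * (C * 2 ^ δ)), by positivity, fun X hX => ?_⟩
  set W := ⌊√(X / 2)⌋₊ with hW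
  have hW1 : √(X / 2) < W + 1 := Nat.lt_floor_add_one _
  have hW2 : (W : ℝ) ≤ √(X / 2) := Nat.floor_le (Real.sqrt_nonneg _)
  have hsq : √(X / 2) * √(X / 2) = X / 2 := Real.mul_self_sqrt (by linarith)
  -- The box has at least `X / 2` points, all with `|k|² ≤ X`, and each value of `|k|²` is attained
  -- `O(X ^ δ)` times, so many values occur.
  set Q : Finset (ℤ × ℤ) := (Finset.range (W + 1) ×ˢ Finset.range (W + 1)).image
    fun k => ((k.1 : ℤ), (k.2 : ℤ)) with hQ
  have hQcard : Q.card = (W + 1) * (W + 1) := by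
    rw [hQ, Finset.card_image_of_injective, Finset.card_product, Finset.card_range]
    rintro ⟨a, b⟩ ⟨c, d⟩ h
    simpa using h
  set V : Finset ℕ := Q.image nsq with hV
  have hVX : ∀ n ∈ V, (n : ℝ) ≤ X := by
    intro n hn
    simp only [hV, hQ, Finset.mem_image, Finset.mem_product, Finset.mem_range,
      Nat.lt_succ_iff] at hn
    obtain ⟨_, ⟨⟨a, b⟩, ⟨ha, hb⟩, rfl⟩, rfl⟩ := hn
    rw [nsq_cast]
    have ha' : (a : ℝ) ≤ √(X / 2) := le_trans (by exact_mod_cast ha) hW2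
    have hb' : (b : ℝ) ≤ √(X / 2) := le_trans (by exact_mod_cast hb) hW2
    push_cast
    nlinarith [Nat.cast_nonneg (α := ℝ) a, Nat.cast_nonneg (α := ℝ) b]
  have hfin : (range nsq ∩ {n : ℕ | (n : ℝ) ≤ X}).Finite := by
    refine (Set.finite_Iic ⌊X⌋₊).subset ?_
    rintro n ⟨-, hn⟩
    exact Nat.le_floor hn
  have hVsub : (V : Set ℕ) ⊆ range nsq ∩ {n : ℕ | (n : ℝ) ≤ X} := by
    intro n hn
    refine ⟨?_, hVX n hn⟩
    obtain ⟨k, -, rfl⟩ := Finset.mem_image.1 hn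
    exact mem_range_self k
  have hVcard : (V.card : ℝ) ≤ ((range nsq ∩ {n : ℕ | (n : ℝ) ≤ X}).ncard : ℝ) := by
    have := Set.ncard_le_ncard hVsub hfin
    rw [Set.ncard_coe_finset] at this
    exact_mod_cast this
  have h1 : (Q.card : ℝ) ≤ V.card * (C * (1 + X) ^ δ) := by
    rw [Finset.card_eq_sum_card_image nsq Q, ← hV]
    push_cast
    rw [← nsmul_eq_mul]
    refine Finset.sum_le_card_nsmul _ _ _ fun n hn => ?_
    calc (((Q.filter fun k => nsq k = n).card : ℕ) : ℝ) ≤ ({k : ℤ × ℤ | nsq k = n}.ncard : ℝ) := by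
          rw [← Set.ncard_coe_finset]
          refine Nat.cast_le.2 (Set.ncard_le_ncard ?_ (finite_nsq_eq n))
          intro k hk
          simpa using (Finset.mem_filter.1 hk).2
      _ ≤ C * (1 + n) ^ δ := hr n
      _ ≤ _ := by gcongr; exact hVX n hn
  have h2 : X / 2 ≤ (Q.card : ℝ) := by
    rw [hQcard]
    push_cast
    nlinarith [Real.sqrt_nonneg (X / 2)]
  have h3 : (1 + X) ^ δ ≤ 2 ^ δ * X ^ δ := by
    rw [← Real.mul_rpow (by norm_num) (by linarith)]
    gcongr
    linarith
  have h4 : X / 2 ≤ V.card * (C * (2 ^ δ * X ^ δ)) := by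
    refine h2.trans (h1.trans ?_)
    gcongr
  refine le_trans ?_ hVcard
  rw [Real.rpow_sub (by linarith), Real.rpow_one]
  have h5 : 0 < X ^ δ := by positivity
  have h6 : (0 : ℝ) < 2 ^ δ := by positivity
  rw [div_mul_div_comm, one_mul, div_le_iff₀ (by positivity)]
  nlinarith

/-! ### Exceptional elements of `Λ₀` and their density -/

/-- The spectral window around `lam` contains two lattice points with a small nonzero difference. -/
def HasNearPair (δ lam : ℝ) : Prop :=
  ∃ k l : ℤ × ℤ, l ≠ 0 ∧ (nsq l : ℝ) ≤ lam ^ (2 * δ) ∧ |(nsq k : ℝ) - lam| < lam ^ (1 / 4 - 3 * δ) ∧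
    |(nsq (k + l) : ℝ) - lam| < lam ^ (1 / 4 - 3 * δ)

/-- Close to `lam` there is `|k|²` with `k · x` away from `π ℤ`. -/
def HasNonresonant (x : Fin 2 → ℝ) (δ lam : ℝ) : Prop :=
  ∃ k : ℤ × ℤ, |(nsq k : ℝ) - lam| ≤ lam ^ δ ∧ lam ^ (-δ) ≤ |sin (dot k x)|

lemma mem_laplaceEigenvalues {n : ℕ} (hn : n ∈ range nsq) : (n : ℝ) ∈ laplaceEigenvalues := by
  obtain ⟨k, rfl⟩ := hn
  rw [laplaceEigenvalues_eq]
  exact mem_range_self k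

lemma finite_laplaceEigenvalues (X : ℝ) : (laplaceEigenvalues ∩ Icc 0 X).Finite := by
  refine ((Set.finite_Iic ⌊X⌋₊).image (Nat.cast : ℕ → ℝ)).subset ?_
  rintro _ ⟨hx, hX⟩
  rw [laplaceEigenvalues_eq] at hx
  obtain ⟨k, rfl⟩ := hx
  exact ⟨nsq k, Nat.le_floor hX.2, rfl⟩

lemma exists_laplaceEigenvalues_gt (X : ℝ) : ∃ a ∈ laplaceEigenvalues, X < a := by
  obtain ⟨n, hn⟩ := exists_nat_gt X
  refine ⟨(nsq (n, 0) : ℝ), mem_laplaceEigenvalues (mem_range_self _), hn.trans_le ?_⟩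
  rw [nsq_cast]
  have : (n : ℝ) ≤ (n : ℝ) ^ 2 := by exact_mod_cast Nat.le_self_pow two_ne_zero n
  push_cast
  linarith

section

variable {Λ₀ : Set ℝ} {C : ℕ}

/-- Elements of `Λ₀` are counted by the eigenvalues that precede them. -/
lemma card_le_of_pred (hE : Λ₀ ∩ laplaceEigenvalues = ∅)
    (h : AtMostBetweenConsecutive C laplaceEigenvalues Λ₀) (S : Finset ℕ) (F : Finset ℝ)
    (hF : ∀ lam ∈ F, lam ∈ Λ₀ ∧ ∃ n ∈ S, n ∈ range nsq ∧ (n : ℝ) ≤ lam ∧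
      ∀ m ∈ range nsq, (m : ℝ) ≤ lam → m ≤ n) : F.card ≤ C * S.card := by
  classical
  set S' : Finset ℝ := (S.filter (· ∈ range nsq)).image (Nat.cast : ℕ → ℝ) with hS'
  have h1 := encard_succInterval_le (inter_comm _ _ ▸ hE) h finite_laplaceEigenvalues
    exists_laplaceEigenvalues_gt S' (by
      intro s hs
      obtain ⟨n, hn, rfl⟩ := Finset.mem_image.1 hs
      exact ⟨mem_laplaceEigenvalues (Finset.mem_filter.1 hn).2, Nat.cast_nonneg _⟩)
  have h2 : (F : Set ℝ) ⊆ succInterval laplaceEigenvalues Λ₀ S' := by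
    intro lam hlam
    obtain ⟨hl, n, hn, hnE, hnl, hmax⟩ := hF lam hlam
    refine ⟨hl, n, Finset.mem_image_of_mem _ (Finset.mem_filter.2 ⟨hn, hnE⟩), hnl, ?_⟩
    intro a ha hal
    rw [laplaceEigenvalues_eq] at ha
    obtain ⟨k, rfl⟩ := ha
    exact Nat.cast_le.2 (hmax _ (mem_range_self k) hal)
  have h3 := (encard_le_encard h2).trans h1
  rw [Set.encard_coe_eq_coe_finsetCard] at h3
  have h4 : F.card ≤ C * S'.card := by exact_mod_cast h3
  refine h4.trans (Nat.mul_le_mul_left _ ?_)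
  exact Finset.card_image_le.trans (Finset.card_filter_le _ _)

lemma exists_pred {lam : ℝ} (hlam : 0 ≤ lam) : ∃ n ∈ range nsq, (n : ℝ) ≤ lam ∧
    ∀ m ∈ range nsq, (m : ℝ) ≤ lam → m ≤ n := by
  classical
  have h0 : 0 ∈ range nsq := ⟨0, by simp [nsq]⟩
  refine ⟨Nat.findGreatest (· ∈ range nsq) ⌊lam⌋₊, ?_, ?_, ?_⟩
  · exact Nat.findGreatest_spec (P := (· ∈ range nsq)) (Nat.zero_le _) h0
  · exact (Nat.le_floor_iff hlam).1 (Nat.findGreatest_le _)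
  · intro m hm hml
    exact Nat.le_findGreatest (Nat.le_floor hml) hm

/-- Elements of `Λ₀` are counted by their integer parts. -/
lemma card_le_of_floor (hE : Λ₀ ∩ laplaceEigenvalues = ∅)
    (h : AtMostBetweenConsecutive C laplaceEigenvalues Λ₀) (T : Finset ℕ) (F : Finset ℝ)
    (hF : ∀ lam ∈ F, lam ∈ Λ₀ ∧ 0 ≤ lam ∧ ⌊lam⌋₊ ∈ T) : F.card ≤ C * T.card := by
  classical
  choose f hf1 hf2 hf3 using fun n : ℕ => exists_pred (Nat.cast_nonneg (α := ℝ) n)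
  refine (card_le_of_pred hE h (T.image f) F fun lam hlam => ?_).trans
    (Nat.mul_le_mul_left _ Finset.card_image_le)
  obtain ⟨hl, hl0, hlT⟩ := hF lam hlam
  refine ⟨hl, f ⌊lam⌋₊, Finset.mem_image_of_mem _ hlT, hf1 _,
    (hf2 _).trans (Nat.floor_le hl0), fun m hm hml => hf3 _ m hm ?_⟩
  exact_mod_cast Nat.le_floor hml

lemma finite_inter_Icc (hE : Λ₀ ∩ laplaceEigenvalues = ∅)
    (h : AtMostBetweenConsecutive C laplaceEigenvalues Λ₀) (X : ℝ) : (Λ₀ ∩ Icc 0 X).Finite := by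
  by_contra hinf
  obtain ⟨F, hFs, hFc⟩ := (show (Λ₀ ∩ Icc 0 X).Infinite from hinf).exists_subset_card_eq
    (C * (⌊X⌋₊ + 1) + 1)
  have := card_le_of_floor hE h (Finset.range (⌊X⌋₊ + 1)) F fun lam hlam =>
    ⟨(hFs hlam).1, (hFs hlam).2.1, by
      rw [Finset.mem_range, Nat.lt_succ_iff]; exact Nat.floor_le_floor (hFs hlam).2.2⟩
  rw [hFc, Finset.card_range] at this
  omega

lemma ceil_le_two_mul {y : ℝ} (hy : 1 ≤ y) : (⌈y⌉₊ : ℝ) ≤ 2 * y := by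
  have := Nat.ceil_lt_add_one (by linarith : 0 ≤ y)
  linarith

lemma natAbs_le_of_nsq_le {k : ℤ × ℤ} {W : ℕ} (h : (nsq k : ℝ) ≤ (W : ℝ) ^ 2) :
    k.1.natAbs ≤ W ∧ k.2.natAbs ≤ W := by
  have h1 : nsq k ≤ W ^ 2 := by exact_mod_cast h
  unfold nsq at h1
  constructor <;> exact (Nat.pow_le_pow_iff_left two_ne_zero).1 (by omega)

/-- Few elements of `Λ₀` have two lattice points with small difference in their window. -/
lemma exists_card_hasNearPair_le (hE : Λ₀ ∩ laplaceEigenvalues = ∅)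
    (h : AtMostBetweenConsecutive C laplaceEigenvalues Λ₀) {δ : ℝ} (hδ : 0 < δ)
    (hδ1 : δ ≤ 1 / 16) :
    ∃ K : ℝ, 0 < K ∧ ∀ X : ℝ, 1 ≤ X → ∀ F : Finset ℝ,
      (∀ lam ∈ F, lam ∈ Λ₀ ∧ 0 ≤ lam ∧ lam ≤ X ∧ HasNearPair δ lam) →
        (F.card : ℝ) ≤ K * X ^ (1 - 4 * δ) := by
  classical
  refine ⟨(C + 1) * (5 ^ 2 * (7 * 9 * 5)), by positivity, fun X hX F hF => ?_⟩
  have hX0 : 0 < X := by linarith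
  set R := ⌈X ^ δ⌉₊ with hR
  set M := ⌈X ^ (1 / 4 - 3 * δ)⌉₊ with hM
  set W := ⌈2 * √X⌉₊ with hW
  have hp1 : 1 ≤ X ^ δ := Real.one_le_rpow hX hδ.le
  have hp2 : 1 ≤ X ^ (1 / 4 - 3 * δ) := Real.one_le_rpow hX (by linarith)
  have hp3 : 1 ≤ √X := Real.one_le_sqrt.2 hX
  have hRb : (R : ℝ) ≤ 2 * X ^ δ := ceil_le_two_mul hp1
  have hMb : (M : ℝ) ≤ 2 * X ^ (1 / 4 - 3 * δ) := ceil_le_two_mul hp2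
  have hWb : (W : ℝ) ≤ 3 * √X := by
    have := Nat.ceil_lt_add_one (by positivity : 0 ≤ 2 * √X)
    linarith
  have hRl : X ^ δ ≤ R := Nat.le_ceil _
  have hMl : X ^ (1 / 4 - 3 * δ) ≤ M := Nat.le_ceil _
  have hWl : 2 * √X ≤ W := Nat.le_ceil _
  have hsq : √X * √X = X := Real.mul_self_sqrt hX0.le
  have hMX : (M : ℝ) ≤ 2 * X := by
    refine hMb.trans ?_
    have : X ^ (1 / 4 - 3 * δ) ≤ X ^ (1 : ℝ) :=
      Real.rpow_le_rpow_of_exponent_le hX (by linarith)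
    rw [Real.rpow_one] at this
    linarith
  set box : ℕ → Finset (ℤ × ℤ) := fun N => Finset.Icc (-(N : ℤ)) N ×ˢ Finset.Icc (-(N : ℤ)) N
    with hbox
  have hmembox : ∀ (N : ℕ) (k : ℤ × ℤ), k.1.natAbs ≤ N → k.2.natAbs ≤ N → k ∈ box N := by
    intro N k h1 h2
    rw [hbox, Finset.mem_product, Finset.mem_Icc, Finset.mem_Icc]
    omega
  set P : ℤ × ℤ → Finset (ℤ × ℤ) := fun l => (box W).filter fun k =>
    k.1.natAbs ≤ W ∧ k.2.natAbs ≤ W ∧ |(nsq (k + l) : ℤ) - nsq k| ≤ (2 * M : ℕ) with hP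
  -- `T` contains the integer part of every bad `lam`: two points of the window have norms at most
  -- `2 * M` apart, which puts `k` in the strip `P l`, and `⌊lam⌋₊` is within `M` of `nsq k`.
  -- Truncated subtraction is harmless, as only a lower bound is needed.
  set T : Finset ℕ := ((box R).filter (· ≠ 0)).biUnion fun l => (P l).biUnion fun k =>
    Finset.Icc (nsq k - M) (nsq k + M) with hT
  have hTcard : T.card ≤ (2 * R + 1) ^ 2 * ((2 * W + 1) * (2 * (2 * M) + 1) * (2 * M + 1)) := by
    refine (Finset.card_biUnion_le_card_mul _ _ ((2 * W + 1) * (2 * (2 * M) + 1) * (2 * M + 1))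
      fun l hl => ?_).trans ?_
    · refine (Finset.card_biUnion_le_card_mul _ _ (2 * M + 1) fun k _ => ?_).trans ?_
      · rw [Nat.card_Icc]; omega
      · refine Nat.mul_le_mul_right _ ?_
        refine card_strip_le (Finset.mem_filter.1 hl).2 W (2 * M) _ fun k hk => ?_
        exact (Finset.mem_filter.1 hk).2
    · refine Nat.mul_le_mul_right _ ((Finset.card_filter_le _ _).trans ?_)
      rw [hbox, Finset.card_product, Int.card_Icc, sq]
      apply Nat.mul_le_mul <;> omega
  have hFT : F.card ≤ C * T.card := by
    refine card_le_of_floor hE h T F fun lam hlam => ?_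
    obtain ⟨hl, hl0, hlX, k, l, hl1, hl2, hl3, hl4⟩ := hF lam hlam
    refine ⟨hl, hl0, ?_⟩
    have hM' : lam ^ (1 / 4 - 3 * δ) ≤ M :=
      (Real.rpow_le_rpow hl0 hlX (by linarith)).trans hMl
    have hl3' := abs_lt.1 (hl3.trans_le hM')
    have hl4' := abs_lt.1 (hl4.trans_le hM')
    rw [hT, Finset.mem_biUnion]
    refine ⟨l, ?_, ?_⟩
    · rw [Finset.mem_filter]
      refine ⟨?_, hl1⟩
      have h1 : (nsq l : ℝ) ≤ (R : ℝ) ^ 2 := by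
        refine hl2.trans ((Real.rpow_le_rpow hl0 hlX (by linarith)).trans ?_)
        rw [mul_comm, Real.rpow_mul hX0.le, Real.rpow_two]
        gcongr
      have h2 := natAbs_le_of_nsq_le h1
      exact hmembox R l h2.1 h2.2
    · rw [Finset.mem_biUnion]
      refine ⟨k, ?_, ?_⟩
      · have h1 : (nsq k : ℝ) ≤ (W : ℝ) ^ 2 := by
          nlinarith
        have h2 := natAbs_le_of_nsq_le h1
        rw [hP, Finset.mem_filter]
        refine ⟨hmembox W k h2.1 h2.2, h2.1, h2.2, ?_⟩
        have h3 : |(nsq (k + l) : ℝ) - nsq k| ≤ 2 * M := by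
          rw [abs_le]; constructor <;> linarith
        exact_mod_cast h3
      · rw [Finset.mem_Icc]
        constructor
        · rw [Nat.sub_le_iff_le_add]
          have h1 : (nsq k : ℝ) < lam + M := by linarith
          have h2 := Nat.lt_floor_add_one lam
          have h3 : (nsq k : ℝ) < (⌊lam⌋₊ + M + 1 : ℕ) := by push_cast; linarith
          have h4 : nsq k < ⌊lam⌋₊ + M + 1 := by exact_mod_cast h3
          omega
        · have h1 := Nat.floor_le hl0
          have h2 : (⌊lam⌋₊ : ℝ) < (nsq k + M : ℕ) := by push_cast; linarith
          exact_mod_cast h2.le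
  -- The factors count the differences `l`, the points `k` of each strip, and the integer parts near
  -- each `|k|²`. The window exponent enters twice, so `1/4` is the threshold at which this count
  -- reaches `X`.
  have hexp : (X ^ δ) ^ 2 * (√X * X ^ (1 / 4 - 3 * δ) * X ^ (1 / 4 - 3 * δ)) =
      X ^ (1 - 4 * δ) := by
    rw [Real.sqrt_eq_rpow, ← Real.rpow_natCast, ← Real.rpow_mul hX0.le, ← Real.rpow_add hX0,
      ← Real.rpow_add hX0, ← Real.rpow_add hX0]
    congr 1
    push_cast
    ring
  calc (F.card : ℝ) ≤ (C : ℝ) * ((2 * R + 1) ^ 2 *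
        ((2 * W + 1) * (2 * (2 * M) + 1) * (2 * M + 1))) := by
        exact_mod_cast hFT.trans (Nat.mul_le_mul_left _ hTcard)
    _ ≤ (C + 1) * ((5 * X ^ δ) ^ 2 * ((7 * √X) * (9 * X ^ (1 / 4 - 3 * δ)) *
        (5 * X ^ (1 / 4 - 3 * δ)))) := by
        gcongr <;> linarith
    _ = (C + 1) * (5 ^ 2 * (7 * 9 * 5)) * ((X ^ δ) ^ 2 *
        (√X * X ^ (1 / 4 - 3 * δ) * X ^ (1 / 4 - 3 * δ))) := by ring
    _ = _ := by rw [hexp]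

/-- For most elements of `Λ₀` there is a non-resonant lattice point in a short window. -/
lemma exists_card_not_hasNonresonant_le (hE : Λ₀ ∩ laplaceEigenvalues = ∅)
    (h : AtMostBetweenConsecutive C laplaceEigenvalues Λ₀) {x₀ : Fin 2 → ℝ}
    (hd : IsDiophantine fun i => x₀ i / π) {δ : ℝ} (hδ : 0 < δ) (hδ1 : δ ≤ 1 / 16) :
    ∃ σ K : ℝ, 0 < σ ∧ σ ≤ δ ∧ 0 < K ∧ ∀ X : ℝ, 1 ≤ X → ∀ F : Finset ℝ,
      (∀ lam ∈ F, lam ∈ Λ₀ ∧ 0 ≤ lam ∧ lam ≤ X ∧ ¬ HasNonresonant x₀ δ lam) →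
        (F.card : ℝ) ≤ K * X ^ (1 - σ) := by
  classical
  obtain ⟨τ, K₁, hτ, hτ1, hK₁, hres⟩ := exists_card_isResonant_le hd
  -- Resonance at scale `X ^ (-δ/2)` costs about `X ^ (1 - δτ/2)`, gaps of length `X ^ (δ/2)` cost
  -- `X ^ (1 - δ/2)`, and elements up to `√X` cost `√X`; since `τ ≤ 1`, the first exponent
  -- dominates. Past `√X` one has `lam ^ δ ≥ X ^ (δ/2)`, so thresholds in `X` suffice.
  refine ⟨δ / 2 * τ, (C + 1) * (2 + 2 + 2 * K₁), by positivity, by nlinarith, by positivity,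
    fun X hX F hF => ?_⟩
  have hX0 : 0 < X := by linarith
  set σ := δ / 2 * τ with hσ
  have hσ0 : 0 < σ := by positivity
  have hσδ : σ ≤ δ / 2 := by rw [hσ]; nlinarith
  have hsqX : √X ≤ X ^ (1 - σ) := by
    rw [Real.sqrt_eq_rpow]
    exact Real.rpow_le_rpow_of_exponent_le hX (by linarith)
  have hone : 1 ≤ X ^ (1 - σ) := Real.one_le_rpow hX (by linarith)
  -- small elements, elements after a long gap, elements after a resonant eigenvalue
  set F₁ := F.filter fun lam => lam ≤ √X with hF₁
  set S₂ := (Finset.range (⌊X⌋₊ + 1)).filter fun n => n ∈ range nsq ∧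
    ∀ m ∈ range nsq, n < m → X ^ (δ / 2) ≤ (m : ℝ) - n with hS₂
  set S₃ := (Finset.range (⌊X⌋₊ + 1)).filter fun n => n ∈ range nsq ∧
    IsResonant x₀ (X ^ (-(δ / 2))) n with hS₃
  set F₂ := F.filter fun lam => ¬ lam ≤ √X with hF₂
  have hc1 : (F₁.card : ℝ) ≤ (C + 1) * (2 * X ^ (1 - σ)) := by
    have h1 : F₁.card ≤ C * (Finset.range (⌊√X⌋₊ + 1)).card := by
      refine card_le_of_floor hE h _ _ fun lam hlam => ?_
      rw [hF₁, Finset.mem_filter] at hlam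
      obtain ⟨hl, hl0, -⟩ := hF lam hlam.1
      refine ⟨hl, hl0, ?_⟩
      rw [Finset.mem_range, Nat.lt_succ_iff]
      exact Nat.floor_le_floor hlam.2
    rw [Finset.card_range] at h1
    calc (F₁.card : ℝ) ≤ (C : ℝ) * ((⌊√X⌋₊ : ℝ) + 1) := by exact_mod_cast h1
      _ ≤ (C + 1) * (2 * X ^ (1 - σ)) := by
        have := Nat.floor_le (Real.sqrt_nonneg X)
        gcongr
        · linarith
        · linarith
  have hS₂c : (S₂.card : ℝ) ≤ 2 * X ^ (1 - σ) := by
    have h1 : (S₂.card : ℝ) ≤ X / X ^ (δ / 2) + 1 := by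
      refine card_le_of_separated hX0.le (by positivity) ?_ ?_
      · intro n hn
        rw [hS₂, Finset.mem_filter, Finset.mem_range, Nat.lt_succ_iff] at hn
        exact (Nat.le_floor_iff hX0.le).1 hn.1
      · intro n hn m hm hnm
        rw [hS₂, Finset.mem_filter] at hn hm
        exact hn.2.2 m hm.2.1 hnm
    have h2 : X / X ^ (δ / 2) ≤ X ^ (1 - σ) := by
      rw [← Real.rpow_one_sub' hX0.le (by linarith)]
      exact Real.rpow_le_rpow_of_exponent_le hX (by linarith)
    linarith
  have hS₃c : (S₃.card : ℝ) ≤ 2 * K₁ * X ^ (1 - σ) := by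
    have h1 := hres (X ^ (-(δ / 2))) (by positivity) X hX S₃ (by
      intro n hn
      rw [hS₃, Finset.mem_filter, Finset.mem_range, Nat.lt_succ_iff] at hn
      exact ⟨(Nat.le_floor_iff hX0.le).1 hn.1, hn.2⟩)
    have h2 : X * (X ^ (-(δ / 2))) ^ τ = X ^ (1 - σ) := by
      rw [← Real.rpow_mul hX0.le, ← Real.rpow_one_add' hX0.le]
      · congr 1; rw [hσ]; ring
      · rw [hσ] at *; nlinarith
    rw [h2] at h1
    nlinarith
  have hc2 : F₂.card ≤ C * (S₂ ∪ S₃).card := by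
    refine card_le_of_pred hE h _ _ fun lam hlam => ?_
    rw [hF₂, Finset.mem_filter, not_le] at hlam
    obtain ⟨hl, hl0, hlX, hnr⟩ := hF lam hlam.1
    refine ⟨hl, ?_⟩
    obtain ⟨n, hnE, hnl, hmax⟩ := exists_pred hl0
    refine ⟨n, ?_, hnE, hnl, hmax⟩
    have hnX : n ∈ Finset.range (⌊X⌋₊ + 1) := by
      rw [Finset.mem_range, Nat.lt_succ_iff]
      exact Nat.le_floor (hnl.trans hlX)
    have hlpos : 0 < lam := (Real.sqrt_pos.2 hX0).trans hlam.2
    have hpow : X ^ (δ / 2) ≤ lam ^ δ := by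
      have : X ^ (δ / 2) = √X ^ δ := by
        rw [Real.sqrt_eq_rpow, ← Real.rpow_mul hX0.le]; congr 1; ring
      rw [this]
      exact Real.rpow_le_rpow (Real.sqrt_nonneg _) hlam.2.le hδ.le
    rw [Finset.mem_union]
    rcases le_or_gt (X ^ (δ / 2)) (lam - n) with hgap | hgap
    · left
      rw [hS₂, Finset.mem_filter]
      refine ⟨hnX, hnE, fun m hm hnm => ?_⟩
      have : lam < m := by
        by_contra! hle
        exact absurd (hmax m hm hle) (by omega)
      linarith
    · right
      rw [hS₃, Finset.mem_filter]
      refine ⟨hnX, hnE, fun k hk => ?_⟩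
      by_contra! hsin
      apply hnr
      refine ⟨k, ?_, ?_⟩
      · rw [hk, abs_sub_comm, abs_of_nonneg (by linarith)]
        linarith
      · refine le_trans ?_ hsin
        rw [Real.rpow_neg hlpos.le, Real.rpow_neg hX0.le]
        exact inv_anti₀ (by positivity) hpow
  have hc2' : (F₂.card : ℝ) ≤ (C + 1) * (2 * X ^ (1 - σ) + 2 * K₁ * X ^ (1 - σ)) := by
    calc (F₂.card : ℝ) ≤ (C : ℝ) * (S₂ ∪ S₃).card := by exact_mod_cast hc2
      _ ≤ (C : ℝ) * (S₂.card + S₃.card) := by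
        gcongr; exact_mod_cast Finset.card_union_le _ _
      _ ≤ _ := by gcongr; linarith
  have hsplit : (F.card : ℝ) = F₁.card + F₂.card := by
    rw [hF₁, hF₂]
    exact_mod_cast (Finset.card_filter_add_card_filter_not _).symm
  rw [hsplit]
  linarith

/-- An unbounded set that weakly interlaces with the eigenvalues is not much sparser. -/
lemma exists_ncard_sumSq_le (hE : Λ₀ ∩ laplaceEigenvalues = ∅)
    (h : AtMostBetweenConsecutive C laplaceEigenvalues Λ₀)
    (h' : AtMostBetweenConsecutive C Λ₀ laplaceEigenvalues) (hunb : ∀ X, ∃ a ∈ Λ₀, X < a) :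
    ∃ M : ℝ, ∀ X : ℝ, ((range nsq ∩ {n : ℕ | (n : ℝ) ≤ X}).ncard : ℝ) ≤
      M + C * ((Λ₀ ∩ Icc 0 X).ncard : ℝ) := by
  classical
  obtain ⟨t, ht, ht0⟩ := hunb 0
  have hfin := finite_inter_Icc hE h
  -- Eigenvalues up to `t` have perhaps no predecessor in `Λ₀` and go into the constant; those
  -- beyond `t` have one in `[0, X]`.
  refine ⟨⌊t⌋₊ + 1, fun X => ?_⟩
  set S := (hfin X).toFinset with hS
  have h1 := encard_succInterval_le hE h' hfin hunb S (by
    intro s hs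
    rw [hS, Set.Finite.mem_toFinset] at hs
    exact ⟨hs.1, hs.2.1⟩)
  have hfin2 : (succInterval Λ₀ laplaceEigenvalues S).Finite :=
    Set.finite_of_encard_le_coe h1
  have h2 : (succInterval Λ₀ laplaceEigenvalues S).ncard ≤ C * S.card := by
    rw [← hfin2.cast_ncard_eq] at h1
    exact_mod_cast h1
  have hsub : (Nat.cast : ℕ → ℝ) '' (range nsq ∩ {n : ℕ | (n : ℝ) ≤ X}) ⊆
      (Nat.cast : ℕ → ℝ) '' (Finset.range (⌊t⌋₊ + 1) : Set ℕ) ∪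
        succInterval Λ₀ laplaceEigenvalues S := by
    rintro _ ⟨n, ⟨hnE, hnX⟩, rfl⟩
    rcases le_or_gt (n : ℝ) t with hnt | hnt
    · left
      refine ⟨n, ?_, rfl⟩
      rw [Finset.mem_coe, Finset.mem_range, Nat.lt_succ_iff]
      exact Nat.le_floor hnt
    · right
      obtain ⟨s, hs, hts, hsn, hmax⟩ := exists_prev hfin ht ht0.le hnt.le
      refine ⟨mem_laplaceEigenvalues hnE, s, ?_, hsn, hmax⟩
      rw [hS, Set.Finite.mem_toFinset]
      exact ⟨hs, ht0.le.trans hts, hsn.trans hnX⟩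
  have h3 := Set.ncard_le_ncard hsub (((Finset.finite_toSet _).image _).union hfin2)
  rw [Set.ncard_image_of_injective _ Nat.cast_injective] at h3
  have h4 : ((Nat.cast : ℕ → ℝ) '' (Finset.range (⌊t⌋₊ + 1) : Set ℕ)).ncard ≤ ⌊t⌋₊ + 1 := by
    refine (Set.ncard_image_le (Finset.finite_toSet _)).trans ?_
    rw [Set.ncard_coe_finset, Finset.card_range]
  have h5 := h3.trans ((Set.ncard_union_le _ _).trans (add_le_add h4 h2))
  rw [Set.ncard_eq_toFinset_card _ (hfin X)]
  exact_mod_cast h5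

end

/-- The elements of `Λ₀` along which the eigenfunctions equidistribute. -/
def goodSet (Λ₀ : Set ℝ) (x₀ : Fin 2 → ℝ) (δ : ℝ) : Set ℝ :=
  {lam | lam ∈ Λ₀ ∧ ¬ HasNearPair δ lam ∧ HasNonresonant x₀ δ lam}

/-- Bad elements number `O(X ^ (1 - σ))`. Applying the lower bound for sums of two squares with loss
`σ / 2` leaves at least a constant times `X ^ (1 - σ/2)` elements of `Λ₀`, and the quotient decays
like `X ^ (-σ/2)`. -/
lemma hasDensityOne_goodSet {Λ₀ : Set ℝ} (hΛ₀ : WeaklyInterlaces Λ₀ laplaceEigenvalues)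
    {x₀ : Fin 2 → ℝ} (hd : IsDiophantine fun i => x₀ i / π) {δ : ℝ} (hδ : 0 < δ)
    (hδ1 : δ ≤ 1 / 16) (hunb : ∀ X, ∃ a ∈ Λ₀, X < a) :
    HasDensityOne (goodSet Λ₀ x₀ δ) Λ₀ := by
  classical
  refine ⟨fun lam h => h.1, ?_⟩
  obtain ⟨hE, C, h', h⟩ := hΛ₀
  obtain ⟨K₁, hK₁, hb1⟩ := exists_card_hasNearPair_le hE h hδ hδ1
  obtain ⟨σ, K₂, hσ, hσδ, hK₂, hb2⟩ := exists_card_not_hasNonresonant_le hE h hd hδ hδ1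
  obtain ⟨c, hc, hlow⟩ := exists_le_ncard_sumSq (half_pos hσ)
  obtain ⟨M, hM⟩ := exists_ncard_sumSq_le hE h h' hunb
  have hfin := finite_inter_Icc hE h
  have hbad : ∀ X : ℝ, 1 ≤ X →
      (((Λ₀ \ goodSet Λ₀ x₀ δ) ∩ Icc 0 X).ncard : ℝ) ≤ (K₁ + K₂) * X ^ (1 - σ) := by
    intro X hX
    have hf : ((Λ₀ \ goodSet Λ₀ x₀ δ) ∩ Icc 0 X).Finite :=
      (hfin X).subset fun x hx => ⟨hx.1.1, hx.2⟩
    set F := hf.toFinset with hF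
    have hmem : ∀ lam ∈ F, lam ∈ Λ₀ ∧ 0 ≤ lam ∧ lam ≤ X ∧
        (HasNearPair δ lam ∨ ¬ HasNonresonant x₀ δ lam) := by
      intro lam hlam
      rw [hF, Set.Finite.mem_toFinset] at hlam
      refine ⟨hlam.1.1, hlam.2.1, hlam.2.2, ?_⟩
      by_contra! hcon
      exact hlam.1.2 ⟨hlam.1.1, hcon.1, hcon.2⟩
    rw [Set.ncard_eq_toFinset_card _ hf, ← hF]
    have h1 := hb1 X hX (F.filter fun lam => HasNearPair δ lam) (by
      intro lam hlam
      rw [Finset.mem_filter] at hlam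
      obtain ⟨a, b, c, -⟩ := hmem lam hlam.1
      exact ⟨a, b, c, hlam.2⟩)
    have h2 := hb2 X hX (F.filter fun lam => ¬ HasNearPair δ lam) (by
      intro lam hlam
      rw [Finset.mem_filter] at hlam
      obtain ⟨a, b, c, d⟩ := hmem lam hlam.1
      exact ⟨a, b, c, d.resolve_left hlam.2⟩)
    have h3 : X ^ (1 - 4 * δ) ≤ X ^ (1 - σ) :=
      Real.rpow_le_rpow_of_exponent_le hX (by linarith)
    have h4 : (F.card : ℝ) = (F.filter fun lam => HasNearPair δ lam).card +
        (F.filter fun lam => ¬ HasNearPair δ lam).card := by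
      exact_mod_cast (Finset.card_filter_add_card_filter_not _).symm
    rw [h4, add_mul]
    refine add_le_add (h1.trans ?_) h2
    gcongr
  have hlow2 : ∀ᶠ X : ℝ in atTop,
      c / 2 / (C + 1) * X ^ (1 - σ / 2) ≤ ((Λ₀ ∩ Icc 0 X).ncard : ℝ) := by
    have ht : Tendsto (fun X : ℝ => c / 2 * X ^ (1 - σ / 2)) atTop atTop :=
      (tendsto_rpow_atTop (by linarith)).const_mul_atTop (by positivity)
    filter_upwards [ht.eventually_ge_atTop M, eventually_ge_atTop 1] with X h1 h2
    have h3 := hlow X h2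
    have h4 := hM X
    rw [div_mul_eq_mul_div, div_le_iff₀ (by positivity)]
    have h5 : (0 : ℝ) ≤ ((Λ₀ ∩ Icc 0 X).ncard : ℝ) := by positivity
    nlinarith
  have hlim : Tendsto (fun X : ℝ => (K₁ + K₂) / (c / 2 / (C + 1)) * X ^ (-(σ / 2))) atTop
      (𝓝 0) := by
    have := (tendsto_rpow_neg_atTop (half_pos hσ)).const_mul ((K₁ + K₂) / (c / 2 / (C + 1)))
    simpa using this
  refine squeeze_zero' (Eventually.of_forall fun X => by positivity) ?_ hlim
  filter_upwards [hlow2, eventually_ge_atTop 1] with X h1 h2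
  have hX0 : 0 < X := by linarith
  have hpos : 0 < c / 2 / ((C : ℝ) + 1) * X ^ (1 - σ / 2) := by positivity
  calc _ ≤ (K₁ + K₂) * X ^ (1 - σ) / (c / 2 / (C + 1) * X ^ (1 - σ / 2)) := by
        gcongr
        exact hbad X h2
    _ = (K₁ + K₂) / (c / 2 / (C + 1)) * (X ^ (1 - σ) / X ^ (1 - σ / 2)) := by
        rw [mul_div_mul_comm]
    _ = _ := by
        rw [← Real.rpow_sub hX0]
        congr 2
        ring

/-! ### Tail sums and correlations of Fourier coefficients -/

/-- The part of the lattice sum of `(|k|² - lam)⁻²` outside a window of half-width `L`. -/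
lemma exists_sum_inv_sq_le {δ : ℝ} (hδ : 0 < δ) (hδ1 : δ ≤ 1 / 16) :
    ∃ C : ℝ, 0 < C ∧ ∀ lam : ℝ, 1 ≤ lam → ∀ L : ℝ, 1 ≤ L → ∀ s : Finset (ℤ × ℤ),
      (∀ k ∈ s, L ≤ |(nsq k : ℝ) - lam|) →
        ∑ k ∈ s, (((nsq k : ℝ) - lam) ^ 2)⁻¹ ≤ C * lam ^ δ * L ^ (-1 + 2 * δ) := by
  classical
  obtain ⟨C₁, hC₁, hr⟩ := exists_ncard_nsq_eq_le hδ
  have hZ : Summable fun j : ℤ => |(j : ℝ)| ^ (-(1 + δ)) :=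
    Real.summable_abs_int_rpow (by linarith)
  set Z := ∑' j : ℤ, |(j : ℝ)| ^ (-(1 + δ)) with hZdef
  have hZ0 : 0 ≤ Z := tsum_nonneg fun j => by positivity
  refine ⟨C₁ * 4 ^ δ * (2 ^ (1 + δ) * (Z + 1)), by positivity, fun lam hlam L hL s hs => ?_⟩
  have hlam0 : 0 < lam := by linarith
  set V := s.image nsq with hV
  set m : ℤ := ⌊lam⌋ with hm
  have hVD : ∀ n ∈ V, L ≤ |(n : ℝ) - lam| := by
    intro n hn
    obtain ⟨k, hk, rfl⟩ := Finset.mem_image.1 hn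
    exact hs k hk
  -- Lattice points are grouped by `n = |k|²`. With multiplicity `O((lam D) ^ δ)`, the power `D ^
  -- (-2 + δ)` is split into `D ^ (-1 + 2δ)`, bounded through `D ≥ L`, and `D ^ (-(1 + δ))`, which
  -- is summable over the integers once `D` is replaced by `|n - ⌊lam⌋| / 2 ≤ D`.
  have hterm : ∀ n ∈ V, ∑ k ∈ s.filter (fun k => nsq k = n), (((nsq k : ℝ) - lam) ^ 2)⁻¹ ≤
      C₁ * 4 ^ δ * lam ^ δ * L ^ (-1 + 2 * δ) * (2 ^ (1 + δ) * |((n : ℤ) - m : ℤ)| ^ (-(1 + δ))) := by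
    intro n hn
    set D := |(n : ℝ) - lam| with hD
    have hDL : L ≤ D := hVD n hn
    have hD1 : 1 ≤ D := hL.trans hDL
    have hD0 : 0 < D := by linarith
    have hcard : ((s.filter fun k => nsq k = n).card : ℝ) ≤ C₁ * (4 * lam * D) ^ δ := by
      calc (((s.filter fun k => nsq k = n).card : ℕ) : ℝ)
          ≤ ({k : ℤ × ℤ | nsq k = n}.ncard : ℝ) := by
            rw [← Set.ncard_coe_finset]
            refine Nat.cast_le.2 (Set.ncard_le_ncard ?_ (finite_nsq_eq n))
            intro k hk
            simpa using (Finset.mem_filter.1 hk).2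
        _ ≤ C₁ * (1 + n) ^ δ := hr n
        _ ≤ _ := by
            gcongr
            have : (n : ℝ) ≤ lam + D := by
              have := le_abs_self ((n : ℝ) - lam)
              rw [← hD] at this
              linarith
            nlinarith
    have hsum : ∑ k ∈ s.filter (fun k => nsq k = n), (((nsq k : ℝ) - lam) ^ 2)⁻¹ =
        (s.filter fun k => nsq k = n).card * (D ^ 2)⁻¹ := by
      rw [← nsmul_eq_mul, ← Finset.sum_const]
      refine Finset.sum_congr rfl fun k hk => ?_
      rw [(Finset.mem_filter.1 hk).2, hD, sq_abs]
    have hDpow : D ^ δ * (D ^ 2)⁻¹ = D ^ (-1 + 2 * δ) * D ^ (-(1 + δ)) := by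
      rw [← Real.rpow_two, ← Real.rpow_neg hD0.le, ← Real.rpow_add hD0, ← Real.rpow_add hD0]
      congr 1
      ring
    have hDpow1 : D ^ (-1 + 2 * δ) ≤ L ^ (-1 + 2 * δ) :=
      Real.rpow_le_rpow_of_nonpos (by linarith) hDL (by linarith)
    have hnm : (n : ℤ) - m ≠ 0 := by
      intro h
      have h1 : (n : ℝ) = m := by exact_mod_cast sub_eq_zero.1 h
      have h2 := Int.floor_le lam
      have h3 := Int.lt_floor_add_one lam
      rw [← hm] at h2 h3
      have : D < 1 := by rw [hD, h1, abs_lt]; constructor <;> linarith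
      linarith
    have hnm0 : (0 : ℝ) < |((n : ℤ) - m : ℤ)| := by
      exact_mod_cast abs_pos.2 hnm
    have hDpow2 : D ^ (-(1 + δ)) ≤ 2 ^ (1 + δ) * |((n : ℤ) - m : ℤ)| ^ (-(1 + δ)) := by
      have h1 : ((|((n : ℤ) - m : ℤ)| : ℤ) : ℝ) / 2 ≤ D := by
        have h2 := Int.floor_le lam
        have h3 := Int.lt_floor_add_one lam
        rw [← hm] at h2 h3
        have h4 : |(n : ℝ) - m| ≤ D + 1 := by
          have : (n : ℝ) - m = (n - lam) + (lam - m) := by ring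
          rw [this]
          refine (abs_add_le _ _).trans ?_
          rw [← hD]
          have : |lam - m| ≤ 1 := by rw [abs_le]; constructor <;> linarith
          linarith
        push_cast
        linarith
      have h5 := Real.rpow_le_rpow_of_nonpos (by positivity) h1 (by linarith : -(1 + δ) ≤ 0)
      refine h5.trans_eq ?_
      rw [Real.div_rpow hnm0.le (by norm_num), Real.rpow_neg (by norm_num : (0 : ℝ) ≤ 2),
        div_inv_eq_mul, mul_comm]
    rw [hsum]
    calc _ ≤ C₁ * (4 * lam * D) ^ δ * (D ^ 2)⁻¹ := by gcongr
      _ = C₁ * 4 ^ δ * lam ^ δ * (D ^ δ * (D ^ 2)⁻¹) := by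
        rw [Real.mul_rpow (by positivity) hD0.le, Real.mul_rpow (by norm_num) hlam0.le]
        ring
      _ = C₁ * 4 ^ δ * lam ^ δ * (D ^ (-1 + 2 * δ) * D ^ (-(1 + δ))) := by rw [hDpow]
      _ ≤ C₁ * 4 ^ δ * lam ^ δ * (L ^ (-1 + 2 * δ) *
          (2 ^ (1 + δ) * |((n : ℤ) - m : ℤ)| ^ (-(1 + δ)))) := by gcongr
      _ = _ := by ring
  have hVsum : ∑ n ∈ V, ((|((n : ℤ) - m : ℤ)| : ℤ) : ℝ) ^ (-(1 + δ)) ≤ Z := by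
    have hinj : Set.InjOn (fun n : ℕ => (n : ℤ) - m) V := by
      intro a _ b _ hab
      have : (a : ℤ) - m = b - m := hab
      omega
    have h1 : ∑ n ∈ V, ((|((n : ℤ) - m : ℤ)| : ℤ) : ℝ) ^ (-(1 + δ)) =
        ∑ j ∈ V.image (fun n : ℕ => (n : ℤ) - m), |(j : ℝ)| ^ (-(1 + δ)) := by
      rw [Finset.sum_image hinj]
      refine Finset.sum_congr rfl fun n _ => ?_
      rw [Int.cast_abs]
    rw [h1]
    exact hZ.sum_le_tsum _ fun j _ => by positivity
  rw [← Finset.sum_fiberwise_of_maps_to (t := V) (g := nsq)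
    fun k hk => Finset.mem_image_of_mem _ hk]
  refine (Finset.sum_le_sum hterm).trans ?_
  rw [← Finset.mul_sum, ← Finset.mul_sum]
  have hstep : 2 ^ (1 + δ) * ∑ n ∈ V, ((|((n : ℤ) - m : ℤ)| : ℤ) : ℝ) ^ (-(1 + δ)) ≤
      2 ^ (1 + δ) * (Z + 1) := by
    gcongr
    linarith
  calc _ ≤ C₁ * 4 ^ δ * lam ^ δ * L ^ (-1 + 2 * δ) * (2 ^ (1 + δ) * (Z + 1)) := by gcongr
    _ = _ := by ring

/-- If the Fourier coefficients of `F` are concentrated on a set disjoint from its translate by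
`l`, then the `l`-th Fourier coefficient of `|F|²` is small. -/
lemma norm_integral_chr_mul_norm_sq_le {F : Torus → ℂ} (hF : MemLp F 2 volume)
    (P : ℤ × ℤ → Prop) (l : ℤ × ℤ) (hP : ∀ k, ¬ (P k ∧ P (k - l))) {ρ : ℝ} (hρ : 0 < ρ)
    (hout : ∀ s : Finset (ℤ × ℤ), (∀ k ∈ s, ¬ P k) →
      ∑ k ∈ s, ‖coeff F k‖ ^ 2 ≤ ρ ^ 2 * (4 * π ^ 2 * ∫ p, ‖F p‖ ^ 2)) :
    ‖∫ p, chr l p * (‖F p‖ ^ 2 : ℝ)‖ ≤ 2 * ρ * ∫ p, ‖F p‖ ^ 2 := by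
  classical
  set N := 4 * π ^ 2 * ∫ p, ‖F p‖ ^ 2 with hN
  set u : ℤ × ℤ → ℝ := fun k => ‖coeff F k‖ with hu
  set o : ℤ × ℤ → ℝ := fun k => if P k then 0 else u k ^ 2 with ho
  have hsum : HasSum (fun k => u k ^ 2) N := hasSum_norm_coeff_sq hF
  have ho0 : ∀ k, 0 ≤ o k := fun k => by rw [ho]; dsimp only; split_ifs <;> positivity
  have hosum : Summable o := by
    refine hsum.summable.of_nonneg_of_le ho0 fun k => ?_
    rw [ho]; dsimp only; split_ifs
    · positivity
    · exact le_rfl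
  have hoT : ∑' k, o k ≤ ρ ^ 2 * N := by
    refine hosum.tsum_le_of_sum_le fun s => ?_
    have h := hout (s.filter fun k => ¬ P k) (fun k hk => (Finset.mem_filter.1 hk).2)
    rw [Finset.sum_filter] at h
    refine le_trans (le_of_eq ?_) h
    refine Finset.sum_congr rfl fun k _ => ?_
    rw [ho]; dsimp only; split_ifs <;> simp_all
  have hshift : ∀ {f : ℤ × ℤ → ℝ} {a : ℝ}, HasSum f a → HasSum (fun k => f (k - l)) a :=
    fun h => (Equiv.subRight l).hasSum_iff.2 h
  have hbound : HasSum (fun k => (o k / ρ + ρ * u (k - l) ^ 2) / 2 +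
      (ρ * u k ^ 2 + o (k - l) / ρ) / 2)
      (((∑' k, o k) / ρ + ρ * N) / 2 + (ρ * N + (∑' k, o k) / ρ) / 2) := by
    have h1 := hosum.hasSum.div_const ρ
    have h2 := hsum.mul_left ρ
    exact ((h1.add (hshift h2)).div_const 2).add ((h2.add (hshift h1)).div_const 2)
  -- Weighted AM-GM: the factor outside `P` gets weight `1 / ρ` and the other gets `ρ`. Outside mass
  -- `ρ² N` and total mass `N` then both contribute `ρ N`.
  have hamgm : ∀ x y : ℝ, x * y ≤ (x ^ 2 / ρ + ρ * y ^ 2) / 2 := by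
    intro x y
    rw [le_div_iff₀ two_pos, div_add' _ _ _ hρ.ne', le_div_iff₀ hρ]
    nlinarith [sq_nonneg (x - ρ * y)]
  have hle : ∀ k, ‖conj (coeff F k) * coeff F (k - l)‖ ≤ (o k / ρ + ρ * u (k - l) ^ 2) / 2 +
      (ρ * u k ^ 2 + o (k - l) / ρ) / 2 := by
    intro k
    rw [norm_mul, RCLike.norm_conj]
    have h1 : 0 ≤ (o k / ρ + ρ * u (k - l) ^ 2) / 2 := by have := ho0 k; positivity
    have h2 : 0 ≤ (ρ * u k ^ 2 + o (k - l) / ρ) / 2 := by have := ho0 (k - l); positivity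
    by_cases hk : P k
    · have hkl : ¬ P (k - l) := fun h => hP k ⟨hk, h⟩
      have h3 : o (k - l) = u (k - l) ^ 2 := if_neg hkl
      have h4 := hamgm (u (k - l)) (u k)
      rw [h3] at h2 ⊢
      rw [mul_comm]
      linarith
    · have h3 : o k = u k ^ 2 := if_neg hk
      have h4 := hamgm (u k) (u (k - l))
      rw [h3] at h1 ⊢
      linarith
  have h1 := tsum_of_norm_bounded hbound hle
  rw [(hasSum_coeff_shift hF l).tsum_eq, norm_mul, Complex.norm_of_nonneg (by positivity)] at h1
  have h2 : (∑' k, o k) / ρ ≤ ρ * N := by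
    rw [div_le_iff₀ hρ]
    linarith
  have h3 : 4 * π ^ 2 * ‖∫ p, chr l p * (‖F p‖ ^ 2 : ℝ)‖ ≤ 4 * π ^ 2 * (2 * ρ * ∫ p, ‖F p‖ ^ 2) := by
    refine h1.trans ?_
    have : 4 * π ^ 2 * (2 * ρ * ∫ p, ‖F p‖ ^ 2) = 2 * ρ * N := by rw [hN]; ring
    linarith
  exact le_of_mul_le_mul_left h3 (by positivity)

/-- The integral of `|F|²` against a smooth function, when the low Fourier coefficients of `|F|²`
are small. -/
lemma norm_integral_mul_norm_sq_sub_le {a : Torus → ℂ} (ha : SmoothOnTorus a) (m : ℕ)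
    {F : Torus → ℂ} (hF : MemLp F 2 volume) {r Y : ℝ} (hr : 0 ≤ r) (hY : 0 < Y)
    (h : ∀ l, l ≠ 0 → (nsq l : ℝ) ≤ Y →
      ‖∫ p, chr l p * (‖F p‖ ^ 2 : ℝ)‖ ≤ r * ∫ p, ‖F p‖ ^ 2) :
    ‖(∫ p, a p * (‖F p‖ ^ 2 : ℝ)) - ((4 * π ^ 2 : ℝ) : ℂ)⁻¹ * (∫ p, a p) * (∫ p, ‖F p‖ ^ 2 : ℝ)‖ ≤
      (4 * π ^ 2)⁻¹ * (∑' k, ‖coeff a k‖ * (1 + (nsq k : ℝ)) ^ m) * (r + (Y ^ m)⁻¹) *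
        ∫ p, ‖F p‖ ^ 2 := by
  set c : ℂ := ((4 * π ^ 2 : ℝ) : ℂ)⁻¹ with hc
  have hcn : ‖c‖ = (4 * π ^ 2)⁻¹ := by
    rw [hc, norm_inv, Complex.norm_of_nonneg (by positivity)]
  set I := ∫ p, ‖F p‖ ^ 2 with hI
  have hI0 : 0 ≤ I := integral_nonneg fun p => by positivity
  have hF2 : Integrable (fun p => ‖F p‖ ^ 2) := hF.integrable_norm_pow two_ne_zero
  have hF2c : Integrable (fun p => ((‖F p‖ ^ 2 : ℝ) : ℂ)) := hF2.ofReal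
  have hs0 : Summable fun k => ‖coeff a k‖ := by
    simpa using summable_norm_coeff_mul_pow ha 0
  have hsm := summable_norm_coeff_mul_pow ha m
  set J : ℤ × ℤ → ℂ := fun k => ∫ p, chr k p * (‖F p‖ ^ 2 : ℝ) with hJ
  have hJ0 : J 0 = I := by
    rw [hJ]
    dsimp only
    rw [chr_zero]
    simp only [ContinuousMap.one_apply, one_mul]
    rw [integral_complex_ofReal]
  have hJI : ∀ k, ‖J k‖ ≤ I := by
    intro k
    refine (norm_integral_le_integral_norm _).trans_eq ?_
    rw [hI]
    congr 1
    ext p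
    rw [norm_mul, norm_chr, one_mul, Complex.norm_of_nonneg (by positivity)]
  have hexp : HasSum (fun k => c * coeff a k * J k) (∫ p, a p * (‖F p‖ ^ 2 : ℝ)) := by
    have hint : ∀ k, Integrable (fun p => c * coeff a k * (chr k p * (‖F p‖ ^ 2 : ℝ))) := fun k =>
      (integrable_chr_mul hF2c k).const_mul _
    have h1 := hasSum_integral_of_summable_integral_norm hint (by
      have : ∀ k, ∫ p, ‖c * coeff a k * (chr k p * (‖F p‖ ^ 2 : ℝ))‖ = ‖coeff a k‖ * (‖c‖ * I) := by
        intro k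
        rw [hI, ← integral_const_mul, ← integral_const_mul]
        congr 1
        ext p
        rw [norm_mul, norm_mul, norm_mul, norm_chr, Complex.norm_of_nonneg (by positivity)]
        ring
      simp only [this]
      exact hs0.mul_right _)
    simp only [integral_const_mul] at h1
    convert! h1 using 1
    congr 1
    ext p
    have h2 := (hasSum_coeff_mul_chr ha.continuous hs0 p).mul_right ((‖F p‖ ^ 2 : ℝ) : ℂ)
    rw [← h2.tsum_eq]
    simp only [hc, mul_assoc]
  have hcoeff0 : coeff a 0 = ∫ p, a p := by
    unfold coeff
    rw [neg_zero, chr_zero]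
    simp
  -- The frequency `0` is exactly the main term, so only nonzero frequencies remain.
  have hdiff := hexp.sub (hasSum_ite_eq (0 : ℤ × ℤ) (c * (∫ p, a p) * (I : ℂ)))
  have hb := (hsm.hasSum.mul_left ‖c‖).mul_right ((r + (Y ^ m)⁻¹) * I)
  have hfin := tsum_of_norm_bounded hb (f := fun k => c * coeff a k * J k -
      if k = 0 then c * (∫ p, a p) * (I : ℂ) else 0) (by
    intro k
    have hY' : 0 < (Y ^ m)⁻¹ := by positivity
    have hone : (1 : ℝ) ≤ (1 + (nsq k : ℝ)) ^ m :=
      one_le_pow₀ (by linarith [Nat.cast_nonneg (α := ℝ) (nsq k)])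
    split_ifs with hk
    · subst hk
      rw [hcoeff0, hJ0, sub_self, norm_zero]
      positivity
    · rw [sub_zero, norm_mul, norm_mul, mul_assoc, mul_assoc, mul_assoc]
      gcongr
      rcases le_or_gt (nsq k : ℝ) Y with hkY | hkY
      · calc ‖J k‖ ≤ r * I := h k hk hkY
          _ ≤ 1 * ((r + (Y ^ m)⁻¹) * I) := by rw [one_mul]; gcongr; linarith
          _ ≤ _ := by gcongr
      -- High frequencies: the trivial bound `|J k| ≤ I` suffices, since the weight `(1 + |k|²) ^ m`
      -- exceeds `Y ^ m`.
      · have h1 : 1 ≤ (1 + (nsq k : ℝ)) ^ m * (Y ^ m)⁻¹ := by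
          rw [← div_eq_mul_inv, one_le_div (by positivity)]
          gcongr
          linarith
        calc ‖J k‖ ≤ 1 * I := by rw [one_mul]; exact hJI k
          _ ≤ ((1 + (nsq k : ℝ)) ^ m * (Y ^ m)⁻¹) * I := by gcongr
          _ ≤ (1 + (nsq k : ℝ)) ^ m * ((r + (Y ^ m)⁻¹) * I) := by
            rw [mul_assoc]; gcongr; linarith)
  rw [hdiff.tsum_eq, hcn] at hfin
  refine hfin.trans_eq ?_
  ring

/-! ### Superpositions of Green functions and equidistribution -/

/-- With `t = cos θ`, the right side minus the left is `|d₁ + t d₂|² + |d₂ + t d₁|²`. A single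
summand may vanish for special `(d₁, d₂)`, so both signs of `θ` are needed for a uniform bound. -/
lemma norm_chr_comb_sq_add_le {d₁ d₂ : ℂ} (θ : ℝ) :
    (‖d₁‖ ^ 2 + ‖d₂‖ ^ 2) * sin θ ^ 2 ≤
      ‖d₁ + d₂ * conj (Complex.exp (Complex.I * θ))‖ ^ 2 +
        ‖d₁ + d₂ * Complex.exp (Complex.I * θ)‖ ^ 2 := by
  have he : Complex.exp (Complex.I * θ) = ⟨cos θ, sin θ⟩ := by
    rw [mul_comm, Complex.exp_mul_I, ← Complex.ofReal_cos, ← Complex.ofReal_sin]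
    apply Complex.ext <;>
      simp only [Complex.add_re, Complex.add_im, Complex.mul_re, Complex.mul_im,
        Complex.ofReal_re, Complex.ofReal_im, Complex.I_re, Complex.I_im] <;> ring
  rw [he]
  simp only [← Complex.normSq_eq_norm_sq, Complex.normSq_apply, Complex.add_re, Complex.add_im,
    Complex.mul_re, Complex.mul_im, Complex.conj_re, Complex.conj_im]
  have h := Real.sin_sq_add_cos_sq θ
  set s := sin θ
  set t := cos θ
  have hs : s ^ 2 = 1 - t ^ 2 := by linarith
  have hs' : s * s = 1 - t ^ 2 := by linarith
  nlinarith [sq_nonneg (d₁.re + t * d₂.re), sq_nonneg (d₁.im + t * d₂.im),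
    sq_nonneg (d₂.re + t * d₁.re), sq_nonneg (d₂.im + t * d₁.im)]

lemma toReal_eLpNorm_sq {F : Torus → ℂ} (hF : MemLp F 2 volume) :
    (eLpNorm F 2 volume).toReal ^ 2 = ∫ p, ‖F p‖ ^ 2 := by
  have h0 : 0 ≤ ∫ p, ‖F p‖ ^ 2 := integral_nonneg fun p => by positivity
  rw [hF.eLpNorm_eq_integral_rpow_norm two_ne_zero ENNReal.ofNat_ne_top]
  simp only [ENNReal.toReal_ofNat, Real.rpow_ofNat]
  rw [ENNReal.toReal_ofReal (by positivity), ← Real.rpow_natCast, ← Real.rpow_mul h0]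
  norm_num

section

variable {x₁ x₂ : Torus} {x₀ : Fin 2 → ℝ} {lam : ℝ} {G₁ G₂ : Torus → ℂ}

lemma chr_toTorus_eq_exp_dot (k : ℤ × ℤ) (x : Fin 2 → ℝ) :
    chr k (toTorus x) = Complex.exp (Complex.I * (dot k x : ℝ)) := chr_toTorus k x

lemma memLp_green_comb (hG₁ : IsGreenFunction lam x₁ G₁) (hG₂ : IsGreenFunction lam x₂ G₂)
    (d₁ d₂ : ℂ) : MemLp (fun y => d₁ * G₁ y + d₂ * G₂ y) 2 volume :=
  (hG₁.1.const_mul d₁).add (hG₂.1.const_mul d₂)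

/-- The absolute values of the Fourier coefficients of a superposition of Green functions. -/
lemma norm_coeff_green_comb_sq (hx₀ : toTorus x₀ = x₂ - x₁) (hlam : lam ∉ laplaceEigenvalues)
    (hG₁ : IsGreenFunction lam x₁ G₁) (hG₂ : IsGreenFunction lam x₂ G₂) (d₁ d₂ : ℂ) (k : ℤ × ℤ) :
    ‖coeff (fun y => d₁ * G₁ y + d₂ * G₂ y) k‖ ^ 2 =
      ‖d₁ + d₂ * conj (Complex.exp (Complex.I * (dot k x₀ : ℝ)))‖ ^ 2 *
        (((nsq k : ℝ) - lam) ^ 2)⁻¹ := by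
  have hne : (nsq k : ℝ) - lam ≠ 0 := by
    intro h
    exact hlam (sub_eq_zero.1 h ▸ mem_laplaceEigenvalues (mem_range_self k))
  have hint : ∀ {G : Torus → ℂ}, MemLp G 2 volume → Integrable G := fun h =>
    h.integrable one_le_two
  rw [coeff_add ((hint hG₁.1).const_mul d₁) ((hint hG₂.1).const_mul d₂), coeff_const_mul,
    coeff_const_mul]
  have h1 := hG₁.coeff_mul k
  have h2 := hG₂.coeff_mul k
  have h3 : chr (-k) x₂ = chr (-k) x₁ * conj (Complex.exp (Complex.I * (dot k x₀ : ℝ))) := by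
    rw [← chr_toTorus_eq_exp_dot, ← chr_neg, hx₀, ← chr_apply_add]
    congr 1
    abel
  have h4 : ((lam - nsq k : ℝ) : ℂ) * (d₁ * coeff G₁ k + d₂ * coeff G₂ k) =
      chr (-k) x₁ * (d₁ + d₂ * conj (Complex.exp (Complex.I * (dot k x₀ : ℝ)))) := by
    rw [h3] at h2
    push_cast at h1 h2 ⊢
    linear_combination d₁ * h1 + d₂ * h2
  have h5 := congrArg norm h4
  rw [norm_mul, norm_mul, norm_chr, one_mul, Complex.norm_real] at h5
  rw [← h5, mul_pow, Real.norm_eq_abs, sq_abs]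
  field_simp
  ring

lemma norm_comb_sq_le (d₁ d₂ z : ℂ) (hz : ‖z‖ = 1) :
    ‖d₁ + d₂ * z‖ ^ 2 ≤ 2 * (‖d₁‖ ^ 2 + ‖d₂‖ ^ 2) := by
  have h := norm_add_le d₁ (d₂ * z)
  rw [norm_mul, hz, mul_one] at h
  have h0 := norm_nonneg (d₁ + d₂ * z)
  nlinarith [sq_nonneg (‖d₁‖ - ‖d₂‖)]

lemma norm_exp_I_mul (θ : ℝ) : ‖Complex.exp (Complex.I * θ)‖ = 1 := by
  rw [mul_comm, Complex.norm_exp_ofReal_mul_I]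

/-- Lower bound for the norm of a superposition of Green functions. -/
lemma le_integral_green_comb (hx₀ : toTorus x₀ = x₂ - x₁) (hlam : lam ∉ laplaceEigenvalues)
    (hlam1 : 1 ≤ lam) {δ : ℝ} (hnr : HasNonresonant x₀ δ lam)
    (hG₁ : IsGreenFunction lam x₁ G₁) (hG₂ : IsGreenFunction lam x₂ G₂) (d₁ d₂ : ℂ) :
    (‖d₁‖ ^ 2 + ‖d₂‖ ^ 2) * lam ^ (-(4 * δ)) ≤
      4 * π ^ 2 * ∫ p, ‖d₁ * G₁ p + d₂ * G₂ p‖ ^ 2 := by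
  classical
  obtain ⟨k, hk1, hk2⟩ := hnr
  have hl0 : 0 < lam := by linarith
  have hne : (nsq k : ℝ) - lam ≠ 0 := by
    intro h
    exact hlam (sub_eq_zero.1 h ▸ mem_laplaceEigenvalues (mem_range_self k))
  have hkk : k ≠ -k := by
    intro h
    have h1 : k.1 = -k.1 := congrArg Prod.fst h
    have h2 : k.2 = -k.2 := congrArg Prod.snd h
    have h3 : dot k x₀ = 0 := by
      rw [dot, show k.1 = 0 by omega, show k.2 = 0 by omega]; simp
    rw [h3, Real.sin_zero, abs_zero] at hk2
    have : 0 < lam ^ (-δ) := by positivity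
    linarith
  have hsum := hasSum_norm_coeff_sq (memLp_green_comb hG₁ hG₂ d₁ d₂)
  -- Just the two frequencies `±k` are kept: they share the denominator, and their numerators cannot
  -- both be small.
  have h1 := sum_le_hasSum {k, -k} (fun _ _ => by positivity) hsum
  rw [Finset.sum_pair hkk, norm_coeff_green_comb_sq hx₀ hlam hG₁ hG₂,
    norm_coeff_green_comb_sq hx₀ hlam hG₁ hG₂, nsq_neg] at h1
  have h2 : dot (-k) x₀ = -dot k x₀ := by simp [dot]; ring
  have h3 : conj (Complex.exp (Complex.I * (dot (-k) x₀ : ℝ))) =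
      Complex.exp (Complex.I * (dot k x₀ : ℝ)) := by
    rw [h2, ← Complex.exp_conj]
    simp
  rw [h3, ← add_mul] at h1
  refine le_trans ?_ h1
  have h4 := norm_chr_comb_sq_add_le (d₁ := d₁) (d₂ := d₂) (dot k x₀)
  have h5 : (lam ^ (-δ)) ^ 2 ≤ sin (dot k x₀) ^ 2 := by
    rw [← sq_abs (sin _)]
    gcongr
  have h6 : (lam ^ (-δ)) ^ 2 ≤ (((nsq k : ℝ) - lam) ^ 2)⁻¹ := by
    rw [Real.rpow_neg hl0.le, inv_pow, ← sq_abs ((nsq k : ℝ) - lam)]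
    have : 0 < |(nsq k : ℝ) - lam| := abs_pos.2 hne
    gcongr
  have h7 : lam ^ (-(4 * δ)) = (lam ^ (-δ)) ^ 2 * (lam ^ (-δ)) ^ 2 := by
    rw [← pow_add, ← Real.rpow_natCast, ← Real.rpow_mul hl0.le]
    congr 1
    push_cast
    ring
  calc _ = (‖d₁‖ ^ 2 + ‖d₂‖ ^ 2) * (lam ^ (-δ)) ^ 2 * (lam ^ (-δ)) ^ 2 := by rw [h7]; ring
    _ ≤ (‖d₁‖ ^ 2 + ‖d₂‖ ^ 2) * sin (dot k x₀) ^ 2 * (((nsq k : ℝ) - lam) ^ 2)⁻¹ := by gcongr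
    _ ≤ _ := by gcongr

end

/-- Equidistribution along `goodSet`, with constants uniform in the superposition. -/
lemma exists_equidistribution_goodSet {x₁ x₂ : Torus} {x₀ : Fin 2 → ℝ}
    (hx₀ : toTorus x₀ = x₂ - x₁) {Λ₀ : Set ℝ} (hE : Λ₀ ∩ laplaceEigenvalues = ∅) {δ : ℝ}
    (hδ : 0 < δ) (hδ1 : δ ≤ 1 / 16) {a : Torus → ℂ} (ha : SmoothOnTorus a) :
    ∃ K : ℝ, ∀ lam ∈ goodSet Λ₀ x₀ δ, 1 ≤ lam →
      ∀ G₁ G₂ : Torus → ℂ, IsGreenFunction lam x₁ G₁ → IsGreenFunction lam x₂ G₂ →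
        ∀ d₁ d₂ : ℂ, (d₁, d₂) ≠ (0, 0) →
          ‖(∫ x, a x * ((‖l2Normalize (fun y => d₁ * G₁ y + d₂ * G₂ y) x‖ ^ 2 : ℝ) : ℂ)) -
              1 / (4 * (π : ℂ) ^ 2) * ∫ x, a x‖ ≤ K * lam ^ (-1 / 8 + 5 * δ) := by
  obtain ⟨C, hC, htail⟩ := exists_sum_inv_sq_le hδ hδ1
  -- With cutoff `Y = lam ^ (2δ)`, this `m` makes `Y ^ (-m) ≤ lam⁻¹`, well below the target error.
  obtain ⟨m, hm⟩ := exists_nat_gt (1 / (2 * δ))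
  have hm1 : 1 ≤ 2 * δ * m := by
    rw [div_lt_iff₀ (by positivity)] at hm
    linarith
  set B := ∑' k, ‖coeff a k‖ * (1 + (nsq k : ℝ)) ^ m with hB
  have hB0 : 0 ≤ B := tsum_nonneg fun k => by positivity
  refine ⟨(4 * π ^ 2)⁻¹ * B * (2 * √(2 * C) + 1), ?_⟩
  intro lam hlam hlam1 G₁ G₂ hG₁ hG₂ d₁ d₂ hd
  obtain ⟨hlam0, hnp, hnr⟩ := hlam
  have hl0 : 0 < lam := by linarith
  have hlamE : lam ∉ laplaceEigenvalues := fun h =>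
    eq_empty_iff_forall_notMem.1 hE lam ⟨hlam0, h⟩
  set F : Torus → ℂ := fun y => d₁ * G₁ y + d₂ * G₂ y with hFdef
  have hF : MemLp F 2 volume := memLp_green_comb hG₁ hG₂ d₁ d₂
  set I := ∫ p, ‖F p‖ ^ 2 with hI
  set D := ‖d₁‖ ^ 2 + ‖d₂‖ ^ 2 with hD
  have hD0 : 0 < D := by
    by_contra! h
    apply hd
    have h1 : ‖d₁‖ ^ 2 = 0 := by nlinarith [sq_nonneg ‖d₁‖, sq_nonneg ‖d₂‖]
    have h2 : ‖d₂‖ ^ 2 = 0 := by nlinarith [sq_nonneg ‖d₁‖, sq_nonneg ‖d₂‖]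
    simpa using And.intro h1 h2
  have hlow : D * lam ^ (-(4 * δ)) ≤ 4 * π ^ 2 * I :=
    le_integral_green_comb hx₀ hlamE hlam1 hnr hG₁ hG₂ d₁ d₂
  have hI0 : 0 < I := by
    have : 0 < D * lam ^ (-(4 * δ)) := by positivity
    by_contra! h
    nlinarith [pi_pos, sq_nonneg π]
  set L := lam ^ (1 / 4 - 3 * δ) with hL
  have hL1 : 1 ≤ L := Real.one_le_rpow hlam1 (by linarith)
  set ρ := √(2 * C) * lam ^ (-1 / 8 + 5 * δ) with hρ
  have hρ0 : 0 < ρ := by positivity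
  -- `ρ` is chosen so that `ρ²` times the lower bound for the total mass dominates the mass outside
  -- the window; the exponent to compare is `-1/4 + 9δ/2 - 6δ² ≤ -1/4 + 6δ`.
  have hρ2 : 2 * (C * lam ^ δ * L ^ (-1 + 2 * δ)) ≤ ρ ^ 2 * lam ^ (-(4 * δ)) := by
    have h1 : ρ ^ 2 * lam ^ (-(4 * δ)) = 2 * C * lam ^ (-1 / 4 + 6 * δ) := by
      rw [hρ, mul_pow, Real.sq_sqrt (by positivity), ← Real.rpow_natCast, ← Real.rpow_mul hl0.le,
        mul_assoc, ← Real.rpow_add hl0]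
      congr 2
      push_cast
      ring
    have h2 : 2 * (C * lam ^ δ * L ^ (-1 + 2 * δ)) =
        2 * C * lam ^ (δ + (1 / 4 - 3 * δ) * (-1 + 2 * δ)) := by
      rw [hL, ← Real.rpow_mul hl0.le, Real.rpow_add hl0]
      ring
    rw [h1, h2]
    refine mul_le_mul_of_nonneg_left ?_ (by positivity)
    exact Real.rpow_le_rpow_of_exponent_le hlam1 (by nlinarith)
  have hcorr : ∀ l, l ≠ 0 → (nsq l : ℝ) ≤ lam ^ (2 * δ) →
      ‖∫ p, chr l p * (‖F p‖ ^ 2 : ℝ)‖ ≤ 2 * ρ * I := by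
    intro l hl hlY
    refine norm_integral_chr_mul_norm_sq_le hF (fun k => |(nsq k : ℝ) - lam| < L) l ?_ hρ0 ?_
    · rintro k ⟨h1, h2⟩
      exact hnp ⟨k, -l, neg_ne_zero.2 hl, by rwa [nsq_neg], h1, by rwa [← sub_eq_add_neg]⟩
    · intro s hs
      have h1 := htail lam hlam1 L hL1 s fun k hk => not_lt.1 (hs k hk)
      calc ∑ k ∈ s, ‖coeff F k‖ ^ 2 ≤ ∑ k ∈ s, 2 * D * (((nsq k : ℝ) - lam) ^ 2)⁻¹ := by
            refine Finset.sum_le_sum fun k _ => ?_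
            rw [hFdef, norm_coeff_green_comb_sq hx₀ hlamE hG₁ hG₂]
            gcongr
            refine norm_comb_sq_le d₁ d₂ _ ?_
            rw [RCLike.norm_conj, norm_exp_I_mul]
        _ = 2 * D * ∑ k ∈ s, (((nsq k : ℝ) - lam) ^ 2)⁻¹ := by rw [Finset.mul_sum]
        _ ≤ 2 * D * (C * lam ^ δ * L ^ (-1 + 2 * δ)) := by gcongr
        _ = D * (2 * (C * lam ^ δ * L ^ (-1 + 2 * δ))) := by ring
        _ ≤ D * (ρ ^ 2 * lam ^ (-(4 * δ))) := by gcongr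
        _ = ρ ^ 2 * (D * lam ^ (-(4 * δ))) := by ring
        _ ≤ _ := by gcongr
  have hmain := norm_integral_mul_norm_sq_sub_le ha m hF (by positivity : 0 ≤ 2 * ρ)
    (by positivity : 0 < lam ^ (2 * δ)) hcorr
  rw [← hI, ← hB] at hmain
  have hY : ((lam ^ (2 * δ)) ^ m)⁻¹ ≤ lam ^ (-1 / 8 + 5 * δ) := by
    rw [← Real.rpow_natCast, ← Real.rpow_mul hl0.le, ← Real.rpow_neg hl0.le]
    exact Real.rpow_le_rpow_of_exponent_le hlam1 (by linarith)
  have hIC : (I : ℂ) ≠ 0 := by exact_mod_cast hI0.ne'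
  have hnorm : ∀ x, ((‖l2Normalize F x‖ ^ 2 : ℝ) : ℂ) = (I : ℂ)⁻¹ * (‖F x‖ ^ 2 : ℝ) := by
    intro x
    rw [l2Normalize, norm_div, div_pow, Complex.norm_real, Real.norm_eq_abs, sq_abs,
      toReal_eLpNorm_sq hF, ← hI]
    push_cast
    field_simp
  have hrew : (∫ x, a x * ((‖l2Normalize F x‖ ^ 2 : ℝ) : ℂ)) - 1 / (4 * (π : ℂ) ^ 2) * ∫ x, a x =
      (I : ℂ)⁻¹ * ((∫ p, a p * (‖F p‖ ^ 2 : ℝ)) -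
        ((4 * π ^ 2 : ℝ) : ℂ)⁻¹ * (∫ p, a p) * (I : ℂ)) := by
    simp only [hnorm, mul_left_comm (a _)]
    rw [integral_const_mul, mul_sub]
    congr 1
    push_cast
    field_simp
  rw [hrew, norm_mul, norm_inv, Complex.norm_of_nonneg hI0.le, inv_mul_le_iff₀ hI0]
  refine hmain.trans ?_
  calc _ ≤ (4 * π ^ 2)⁻¹ * B * (2 * ρ + lam ^ (-1 / 8 + 5 * δ)) * I := by gcongr
    _ = _ := by rw [hρ]; ring

end

theorem theorem1p1 (x₁ x₂ : Torus) (x₀ : Fin 2 → ℝ) (hx₀ : toTorus x₀ = x₂ - x₁)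
    (hdioph : IsDiophantine (fun i => x₀ i / π))
    (ε : ℝ) (hε : 0 < ε) (Λ₀ : Set ℝ) (hΛ₀ : WeaklyInterlaces Λ₀ laplaceEigenvalues) :
    ∃ Λinf : Set ℝ, HasDensityOne Λinf Λ₀ ∧
      ∀ a : Torus → ℂ, SmoothOnTorus a →
        ∃ K lam₁ : ℝ, ∀ lam ∈ Λinf, lam₁ ≤ lam →
          ∀ G₁ G₂ : Torus → ℂ, IsGreenFunction lam x₁ G₁ → IsGreenFunction lam x₂ G₂ →
            ∀ d₁ d₂ : ℂ, (d₁, d₂) ≠ (0, 0) →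
              ‖(∫ x, a x * ((‖l2Normalize (fun y => d₁ * G₁ y + d₂ * G₂ y) x‖ ^ 2 : ℝ) : ℂ)) -
                  1 / (4 * (π : ℂ) ^ 2) * ∫ x, a x‖ ≤ K * lam ^ (-1 / 8 + ε) := by
  by_cases hunb : ∀ X, ∃ a ∈ Λ₀, X < a
  · set δ := min (ε / 5) (1 / 16) with hδ
    have hδ0 : 0 < δ := by positivity
    have hδ1 : δ ≤ 1 / 16 := min_le_right _ _
    have hδε : 5 * δ ≤ ε := by
      have := min_le_left (ε / 5) (1 / 16)
      linarith
    refine ⟨goodSet Λ₀ x₀ δ, hasDensityOne_goodSet hΛ₀ hdioph hδ0 hδ1 hunb, fun a ha => ?_⟩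
    obtain ⟨K, hK⟩ := exists_equidistribution_goodSet hx₀ hΛ₀.1 hδ0 hδ1 ha
    -- The absolute value makes the constant nonnegative, as is needed to enlarge the power of
    -- `lam`.
    refine ⟨|K|, 1, fun lam hlam hlam1 G₁ G₂ hG₁ hG₂ d₁ d₂ hd => ?_⟩
    refine (hK lam hlam hlam1 G₁ G₂ hG₁ hG₂ d₁ d₂ hd).trans ?_
    have hpow : lam ^ (-1 / 8 + 5 * δ) ≤ lam ^ (-1 / 8 + ε) :=
      Real.rpow_le_rpow_of_exponent_le hlam1 (by linarith)
    have hl0 : 0 < lam := by linarith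
    gcongr
    exact le_abs_self K
  · push Not at hunb
    obtain ⟨X, hX⟩ := hunb
    -- A set bounded above by `X` has no elements beyond `X + 1`, so the estimate is vacuous on all
    -- of `Λ₀`.
    refine ⟨Λ₀, ⟨subset_rfl, by simp⟩, fun a _ => ⟨0, X + 1, fun lam hlam hle => ?_⟩⟩
    linarith [hX lam hlam]
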